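/- Let $\mathcal X\subset\mathbb R^d$ be compact and let $k:\mathcal X\times\mathcal X\to\mathbb R$ be a fixed measurable reproducing kernel with $k(x,x')\le 1$ for all $x,x'\in\mathcal X$. Let $f$ lie in the reproducing kernel Hilbert space $\mathcal H_k$ with $\|f\|_k\le B$, and let $x^\ast\in\arg\max_{x\in\mathcal X}f(x)$. Let $\sigma>0$ be the noise parameter of the Gaussian process (GP) surrogate. For past queries $x_1,\dots,x_{t-1}$ and observations $\mathbf y_{t-1}=(y_1,\dots,y_{t-1})^\top$ put $K_{t-1}=[k(x_i,x_j)]_{i,j<t}$, $k_{t-1}(x)=[k(x_i,x)]_{i<t}$ and $$\mu_{t-1}(x)=k_{t-1}(x)^\top(K_{t-1}+\sigma^2I)^{-1}\mathbf y_{t-1},\qquad \sigma_{t-1}^2(x)=k(x,x)-k_{t-1}(x)^\top(K_{t-1}+\sigma^2I)^{-1}k_{t-1}(x).$$ Let $\gamma_t=\sup_{a_1,\dots,a_t\in\mathcal X}\tfrac12\log\det\big(I+\sigma^{-2}[k(a_i,a_j)]_{i,j\le t}\big)$ be the maximum information gain (repetitions allowed). Fix $\delta\in(0,1)$ and a horizon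 $T$, and let $\beta_t(\delta)$ be non-decreasing in $t\in\{1,\dots,T\}$ with $$\beta_t(\delta)\ \ge\ 2B^2+300\,\gamma_t\,\log^3(t/\delta)\qquad(1\le t\le T);$$ in particular $\beta_t(\delta)=2B^2+300\,\gamma_t\log^3(t/\delta)$ is allowed. GP-UCB is run with the fixed kernel $k$ for $T$ rounds: in round $t$ it queries $$x_t\in\arg\max_{x\in\mathcal X}\ \mu_{t-1}(x)+\sqrt{\beta_t(\delta)}\,\sigma_{t-1}(x)$$ and observes $y_t=f(x_t)+\epsilon_t$. Here $(\mathcal F_t)_{t\ge0}$ is a filtration such that $x_t$ is $\mathcal F_{t-1}$-measurable and $\epsilon_t$ is $\mathcal F_t$-measurable, and the noise is conditionally $R$-sub-Gaussian with $0\le R\le\sigma$: for all $1\le t\le T$ and $\eta\in\mathbb R$, almost surely $$\mathbb E[\exp(\eta\epsilon_t)\mid\mathcal F_{t-1}]\le\exp(\eta^2R^2/2).$$ Then, with probability at least $1-\delta$, the cumulative regret $R_T=\sum_{t=1}^T\big(f(x^\ast)-f(x_t)\big)$ satisfies $$R_T\ \le\ \sqrt{T\sum_{t=1}^T4\,\beta_t(\delta)\,\sigma^2\,C\,\log\!\big(1+\sigma^{-2}\sigma_{t-1}^2(x_t)\big)},\qquad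 C=\frac{\sigma^{-2}}{\log(1+\sigma^{-2})}.$$ -/

import Mathlib

open MeasureTheory

noncomputable section

namespace GPUCB

/-- The Gram matrix `[k (x i) (x j)]` of the query points `x 0, …, x (n - 1)`. -/
def gram {X : Type*} (k : X → X → ℝ) {n : ℕ} (x : Fin n → X) : Matrix (Fin n) (Fin n) ℝ :=
  Matrix.of fun i j => k (x i) (x j)

/-- The regularized Gram matrix `K + σ² I`. -/
def regGram {X : Type*} (k : X → X → ℝ) (σ : ℝ) {n : ℕ} (x : Fin n → X) :
    Matrix (Fin n) (Fin n) ℝ :=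
  gram k x + σ ^ 2 • (1 : Matrix (Fin n) (Fin n) ℝ)

/-- The vector `[k (x i) z]` of covariances between the query points and a test point `z`. -/
def kvec {X : Type*} (k : X → X → ℝ) {n : ℕ} (x : Fin n → X) (z : X) : Fin n → ℝ :=
  fun i => k (x i) z

/-- The Gaussian process predictive mean `k(z)ᵀ (K + σ² I)⁻¹ y`. -/
def postMean {X : Type*} (k : X → X → ℝ) (σ : ℝ) {n : ℕ} (x : Fin n → X) (y : Fin n → ℝ)
    (z : X) : ℝ :=
  kvec k x z ⬝ᵥ Matrix.mulVec (regGram k σ x)⁻¹ y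

/-- The Gaussian process predictive variance `k(z,z) - k(z)ᵀ (K + σ² I)⁻¹ k(z)`. -/
def postVar {X : Type*} (k : X → X → ℝ) (σ : ℝ) {n : ℕ} (x : Fin n → X) (z : X) : ℝ :=
  k z z - kvec k x z ⬝ᵥ Matrix.mulVec (regGram k σ x)⁻¹ (kvec k x z)

/-- The values `u 1, …, u (t - 1)` of a sequence before round `t`. -/
def past {α : Type*} (u : ℕ → α) (t : ℕ) : Fin (t - 1) → α :=
  fun i => u ((i : ℕ) + 1)

/-- The upper confidence bound acquisition function of round `t`, at exploration level `b`,
for the query sequence `x` and the observation sequence `y`. -/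
def ucb {X : Type*} (k : X → X → ℝ) (σ b : ℝ) (x : ℕ → X) (y : ℕ → ℝ) (t : ℕ) (z : X) : ℝ :=
  postMean k σ (past x t) (past y t) z + √b * √(postVar k σ (past x t) z)

/-- The maximum information gain after `t` evaluations: the supremum of
`1/2 log det (I + σ⁻² K_A)` over all `t`-tuples `A` of points (repetitions are allowed). -/
def maxInfoGain {X : Type*} (k : X → X → ℝ) (σ : ℝ) (t : ℕ) : ℝ :=
  ⨆ A : Fin t → X,
    1 / 2 * Real.log (1 + (σ ^ 2)⁻¹ • gram k A : Matrix (Fin t) (Fin t) ℝ).det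

/-- The random variable `e` is conditionally `R`-sub-Gaussian given the σ-algebra `m`:
`E[exp (η e) | m] ≤ exp (η² R² / 2)` almost surely, for every real `η`. -/
def CondSubGaussian {Ω : Type*} {mΩ : MeasurableSpace Ω} (P : Measure Ω)
    (m : MeasurableSpace Ω) (R : ℝ) (e : Ω → ℝ) : Prop :=
  ∀ η : ℝ, Integrable (fun ω => Real.exp (η * e ω)) P ∧
    P[fun ω => Real.exp (η * e ω) | m] ≤ᵐ[P] fun _ => Real.exp (η ^ 2 * R ^ 2 / 2)

end GPUCB

end

/-!
In the feature space with the regularized inner product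
`⟪u, v⟫ + σ⁻² ∑ i, ⟪φ (x i), u⟫ ⟪φ (x i), v⟫`, the residual of ridge regression on `φ z` is the
Riesz representer of evaluation at `z`, and its squared norm is the posterior variance.
Cauchy–Schwarz then bounds the prediction error at every `z` simultaneously by
`(‖h‖ + √(σ⁻² E)) √(postVar z)`, where the noise enters only through its energy
`E = eᵀ K (K + σ² I)⁻¹ e`.

The noise energy is controlled by the method of mixtures. In each round the sub-Gaussian bound is
applied with a predictable Gaussian multiplier; integrating the multiplier out gives a nonnegative
supermartingale whose logarithm is `eᵀ K (K + τ² I)⁻¹ e / (2 σ²)` minus the information gain for the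
regularization `τ`, so Markov's inequality applies. The choice `τ = σ` would leave an additive term
`log (1 / δ)` in the bound on `E`. With `τ² = s σ²` and `s` of the order of the information gain
`γ`, the energy for `τ` exceeds the one for `σ` by a factor of order `1 / s`, because the
eigenvalues of `K` are at most of order `γ σ²` when `γ` is small; so `E` is bounded by a multiple of
`γ`. Round `1` sees no noise, and the failure probabilities `(δ / t)²` of the rounds `t ≥ 2` sum to
at most `δ²`.

On the event that all confidence bounds hold, each round costs at most twice the confidence width
at the chosen point. Bernoulli's inequality compares the posterior variance with
`log (1 + σ⁻² postVar)`, and Cauchy–Schwarz sums over the rounds.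
-/

noncomputable section

namespace GPUCB

open Matrix ProbabilityTheory
open scoped ENNReal

/-! ### Spectral formulas -/

section Spectral

variable {ι : Type*} [Fintype ι] [DecidableEq ι] {K : Matrix ι ι ℝ}

theorem det_one_add_smul_eq_prod_eigenvalues (hK : K.IsHermitian) (c : ℝ) :
    (1 + c • K).det = ∏ i, (1 + c * hK.eigenvalues i) := by
  have hdiag : 1 + c • diagonal hK.eigenvalues = diagonal fun i => 1 + c * hK.eigenvalues i := by
    rw [← diagonal_one, ← diagonal_smul, diagonal_add]; rfl
  have hconj : 1 + c • K = Unitary.conjStarAlgAut ℝ _ hK.eigenvectorUnitary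
      (diagonal fun i => 1 + c * hK.eigenvalues i) := by
    rw [← hdiag, map_add, map_smul, map_one]
    nth_rw 1 [hK.spectral_theorem]; rfl
  rw [hconj, Unitary.conjStarAlgAut_apply, det_mul_right_comm,
    Unitary.mul_star_self_of_mem hK.eigenvectorUnitary.2, one_mul, det_diagonal]

theorem dotProduct_mulVec_mulVec_resolvent (hK : K.IsHermitian) {s : ℝ}
    (hs : ∀ i, hK.eigenvalues i + s ≠ 0) (e : ι → ℝ) :
    e ⬝ᵥ K *ᵥ ((K + s • (1 : Matrix ι ι ℝ))⁻¹ *ᵥ e) =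
      ∑ i, hK.eigenvalues i / (hK.eigenvalues i + s) *
        ((hK.eigenvectorUnitary : Matrix ι ι ℝ)ᵀ *ᵥ e) i ^ 2 := by
  set l := hK.eigenvalues
  set C := Unitary.conjStarAlgAut ℝ (Matrix ι ι ℝ) hK.eigenvectorUnitary
  have hKC : K = C (diagonal l) := hK.spectral_theorem
  have hshift : K + s • (1 : Matrix ι ι ℝ) = C (diagonal fun i => l i + s) := by
    rw [hKC, ← map_one C, ← map_smul, ← map_add, ← diagonal_one, ← diagonal_smul, diagonal_add]
    simp only [Pi.smul_apply, smul_eq_mul, mul_one]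
  have hinv : (K + s • (1 : Matrix ι ι ℝ))⁻¹ = C (diagonal fun i => (l i + s)⁻¹) := by
    apply inv_eq_right_inv
    rw [hshift, ← map_mul, diagonal_mul_diagonal]
    simp only [mul_inv_cancel₀ (hs _), diagonal_one, map_one]
  have hprod : K * (K + s • (1 : Matrix ι ι ℝ))⁻¹ = C (diagonal fun i => l i / (l i + s)) := by
    rw [hinv]
    nth_rw 1 [hKC]
    rw [← map_mul, diagonal_mul_diagonal]
    rfl
  rw [mulVec_mulVec, hprod, Unitary.conjStarAlgAut_apply, star_eq_conjTranspose,
    conjTranspose_eq_transpose_of_trivial, ← mulVec_mulVec, ← mulVec_mulVec, dotProduct_mulVec,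
    ← mulVec_transpose]
  simp only [dotProduct, mulVec_diagonal]
  exact Finset.sum_congr rfl fun i _ => by ring

end Spectral

/-! ### Kernel ridge regression in feature space -/

section Posterior

variable {X H : Type*} [NormedAddCommGroup H] [InnerProductSpace ℝ H] {k : X → X → ℝ} {φ : X → H}
  {σ : ℝ} {n : ℕ}

/-- The map `φ` into an inner product space is a feature map of the kernel `k`. A reproducing
kernel Hilbert space provides one, but the argument works with any. -/
def IsFeatureMap (k : X → X → ℝ) (φ : X → H) : Prop :=
  ∀ z w, k z w = inner ℝ (φ z) (φ w)

theorem isFeatureMap_kerFun [CompleteSpace H] [RKHS ℝ H X ℝ]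
    (hH : ∀ z w, RKHS.kernel H z w 1 = k z w) :
    IsFeatureMap k fun z => RKHS.kerFun H z (1 : ℝ) := fun z w => by
  rw [← hH, RKHS.kerFun_inner, RKHS.kerFun_apply]
  simp

/-- The kernel ridge regression estimate of the observations `y` at the queries `x`, as a vector of
the feature space; `postMean` evaluates it. -/
def ridgeEstimate (k : X → X → ℝ) (φ : X → H) (σ : ℝ) (x : Fin n → X) (y : Fin n → ℝ) : H :=
  ∑ i, ((regGram k σ x)⁻¹ *ᵥ y) i • φ (x i)

/-- The part of the feature vector of `z` that ridge regression on the queries `x` leaves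
unexplained. -/
def ridgeResidual (k : X → X → ℝ) (φ : X → H) (σ : ℝ) (x : Fin n → X) (z : X) : H :=
  φ z - ridgeEstimate k φ σ x (kvec k x z)

/-- The embedding of the feature space that turns the regularized inner product
`⟪u, v⟫ + σ⁻² ∑ i, ⟪φ (x i), u⟫ ⟪φ (x i), v⟫` into an ordinary one. -/
def ridgeEmbedding (φ : X → H) (σ : ℝ) (x : Fin n → X) :
    H →ₗ[ℝ] WithLp 2 (H × EuclideanSpace ℝ (Fin n)) where
  toFun u := WithLp.toLp 2 (u, WithLp.toLp 2 fun i => σ⁻¹ * inner ℝ (φ (x i)) u)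
  map_add' u v := by simp only [inner_add_right, mul_add]; rfl
  map_smul' c u := by simp only [real_inner_smul_right, mul_left_comm σ⁻¹]; rfl

theorem inner_ridgeEmbedding (φ : X → H) (σ : ℝ) (x : Fin n → X) (u v : H) :
    inner ℝ (ridgeEmbedding φ σ x u) (ridgeEmbedding φ σ x v) =
      inner ℝ u v + (σ ^ 2)⁻¹ * ∑ i, inner ℝ (φ (x i)) u * inner ℝ (φ (x i)) v := by
  rw [WithLp.prod_inner_apply, PiLp.inner_apply, Finset.mul_sum]
  change inner ℝ u v + ∑ i, inner ℝ (σ⁻¹ * inner ℝ (φ (x i)) u) (σ⁻¹ * inner ℝ (φ (x i)) v) = _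
  congr 1
  refine Finset.sum_congr rfl fun i _ => ?_
  rw [Real.inner_apply]
  ring

theorem norm_le_norm_ridgeEmbedding (φ : X → H) (σ : ℝ) (x : Fin n → X) (u : H) :
    ‖u‖ ≤ ‖ridgeEmbedding φ σ x u‖ :=
  WithLp.norm_fst_le _ (ridgeEmbedding φ σ x u)

namespace IsFeatureMap

theorem symm (hφ : IsFeatureMap k φ) (z w : X) : k z w = k w z := by
  rw [hφ, hφ, real_inner_comm]

theorem gram_apply (hφ : IsFeatureMap k φ) (x : Fin n → X) (i : Fin n) :
    gram k x i = kvec k x (x i) :=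
  funext fun j => hφ.symm (x i) (x j)

theorem gram_posSemidef (hφ : IsFeatureMap k φ) (x : Fin n → X) : (gram k x).PosSemidef := by
  have hgram : gram k x = Matrix.gram ℝ (fun i => φ (x i)) :=
    Matrix.ext fun i j => hφ (x i) (x j)
  exact hgram ▸ posSemidef_gram ℝ _

theorem regGram_posDef (hφ : IsFeatureMap k φ) (hσ : 0 < σ) (x : Fin n → X) :
    (regGram k σ x).PosDef :=
  (PosDef.one.smul (by positivity)).posSemidef_add (hφ.gram_posSemidef x)

theorem regGram_mulVec_inv_mulVec (hφ : IsFeatureMap k φ) (hσ : 0 < σ) (x : Fin n → X)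
    (y : Fin n → ℝ) : regGram k σ x *ᵥ ((regGram k σ x)⁻¹ *ᵥ y) = y := by
  rw [mulVec_mulVec, mul_nonsing_inv _ (hφ.regGram_posDef hσ x).det_pos.ne'.isUnit, one_mulVec]

theorem gram_mulVec_inv_mulVec (hφ : IsFeatureMap k φ) (hσ : 0 < σ) (x : Fin n → X)
    (y : Fin n → ℝ) :
    gram k x *ᵥ ((regGram k σ x)⁻¹ *ᵥ y) = y - σ ^ 2 • ((regGram k σ x)⁻¹ *ᵥ y) := by
  have h := hφ.regGram_mulVec_inv_mulVec hσ x y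
  rwa [regGram, add_mulVec, smul_mulVec, one_mulVec, ← eq_sub_iff_add_eq] at h

theorem dotProduct_inv_mulVec_comm (hφ : IsFeatureMap k φ) (hσ : 0 < σ) (x : Fin n → X)
    (u v : Fin n → ℝ) :
    u ⬝ᵥ (regGram k σ x)⁻¹ *ᵥ v = v ⬝ᵥ (regGram k σ x)⁻¹ *ᵥ u := by
  have hsymm : ((regGram k σ x)⁻¹)ᵀ = (regGram k σ x)⁻¹ :=
    (hφ.regGram_posDef hσ x).inv.isHermitian
  rw [dotProduct_mulVec, ← mulVec_transpose, hsymm, dotProduct_comm]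

theorem inner_sum_smul (hφ : IsFeatureMap k φ) (x : Fin n → X) (z : X) (w : Fin n → ℝ) :
    inner ℝ (φ z) (∑ i, w i • φ (x i)) = kvec k x z ⬝ᵥ w := by
  simp only [inner_sum, inner_smul_right, dotProduct, kvec, hφ.symm _ z, hφ z, mul_comm]

theorem postMean_eq_inner (hφ : IsFeatureMap k φ) (x : Fin n → X) (y : Fin n → ℝ) (z : X) :
    postMean k σ x y z = inner ℝ (φ z) (ridgeEstimate k φ σ x y) :=
  (hφ.inner_sum_smul x z _).symm

theorem inner_ridgeEmbedding_ridgeEstimate (hφ : IsFeatureMap k φ) (hσ : 0 < σ) (x : Fin n → X)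
    (y : Fin n → ℝ) (u : H) :
    inner ℝ (ridgeEmbedding φ σ x (ridgeEstimate k φ σ x y)) (ridgeEmbedding φ σ x u) =
      (σ ^ 2)⁻¹ * ∑ i, y i * inner ℝ (φ (x i)) u := by
  have hvalue (i : Fin n) : inner ℝ (φ (x i)) (ridgeEstimate k φ σ x y) =
      y i - σ ^ 2 * ((regGram k σ x)⁻¹ *ᵥ y) i := by
    have h := congrFun (hφ.gram_mulVec_inv_mulVec hσ x y) i
    rwa [mulVec, hφ.gram_apply, ← hφ.inner_sum_smul] at h
  rw [inner_ridgeEmbedding]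
  simp only [hvalue, Finset.mul_sum]
  rw [ridgeEstimate, sum_inner, ← Finset.sum_add_distrib]
  refine Finset.sum_congr rfl fun i _ => ?_
  rw [real_inner_smul_left]
  field_simp
  ring

theorem inner_ridgeEmbedding_ridgeResidual (hφ : IsFeatureMap k φ) (hσ : 0 < σ) (x : Fin n → X)
    (z : X) (u : H) :
    inner ℝ (ridgeEmbedding φ σ x (ridgeResidual k φ σ x z)) (ridgeEmbedding φ σ x u) =
      inner ℝ (φ z) u := by
  rw [ridgeResidual, map_sub, inner_sub_left, hφ.inner_ridgeEmbedding_ridgeEstimate hσ,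
    inner_ridgeEmbedding]
  simp only [kvec, ← hφ _ z, add_sub_cancel_right]

theorem postVar_eq_norm_sq (hφ : IsFeatureMap k φ) (hσ : 0 < σ) (x : Fin n → X) (z : X) :
    postVar k σ x z = ‖ridgeEmbedding φ σ x (ridgeResidual k φ σ x z)‖ ^ 2 := by
  rw [← real_inner_self_eq_norm_sq, hφ.inner_ridgeEmbedding_ridgeResidual hσ, ridgeResidual,
    inner_sub_right, ← hφ, ← hφ.postMean_eq_inner]
  rfl

theorem postVar_nonneg (hφ : IsFeatureMap k φ) (hσ : 0 < σ) (x : Fin n → X) (z : X) :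
    0 ≤ postVar k σ x z := by
  rw [hφ.postVar_eq_norm_sq hσ]
  positivity

theorem postVar_le (hφ : IsFeatureMap k φ) (hσ : 0 < σ) (x : Fin n → X) (z : X) :
    postVar k σ x z ≤ k z z :=
  sub_le_self _ ((hφ.regGram_posDef hσ x).inv.posSemidef.dotProduct_mulVec_nonneg (kvec k x z))

end IsFeatureMap

/-- The energy `eᵀ K (K + σ² I)⁻¹ e` of the part of the noise vector `e` that ridge regression
fits. -/
def noiseEnergy (k : X → X → ℝ) (σ : ℝ) (x : Fin n → X) (e : Fin n → ℝ) : ℝ :=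
  e ⬝ᵥ gram k x *ᵥ ((regGram k σ x)⁻¹ *ᵥ e)

namespace IsFeatureMap

theorem noiseEnergy_eq_norm_sq (hφ : IsFeatureMap k φ) (hσ : 0 < σ) (x : Fin n → X)
    (e : Fin n → ℝ) :
    (σ ^ 2)⁻¹ * noiseEnergy k σ x e =
      ‖ridgeEmbedding φ σ x (ridgeEstimate k φ σ x e)‖ ^ 2 := by
  rw [← real_inner_self_eq_norm_sq, hφ.inner_ridgeEmbedding_ridgeEstimate hσ, noiseEnergy]
  congr 1
  refine Finset.sum_congr rfl fun i _ => ?_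
  rw [mulVec, hφ.gram_apply, ridgeEstimate, hφ.inner_sum_smul]

theorem noiseEnergy_nonneg (hφ : IsFeatureMap k φ) (hσ : 0 < σ) (x : Fin n → X)
    (e : Fin n → ℝ) : 0 ≤ noiseEnergy k σ x e := by
  have h : 0 ≤ (σ ^ 2)⁻¹ * noiseEnergy k σ x e := by
    rw [hφ.noiseEnergy_eq_norm_sq hσ]
    positivity
  exact nonneg_of_mul_nonneg_right h (by positivity)

theorem sub_postMean_eq (hφ : IsFeatureMap k φ) (hσ : 0 < σ) (x : Fin n → X) (e : Fin n → ℝ)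
    (h : H) (z : X) :
    inner ℝ h (φ z) - postMean k σ x (fun i => inner ℝ h (φ (x i)) + e i) z =
      inner ℝ h (ridgeResidual k φ σ x z) -
        inner ℝ (ridgeEmbedding φ σ x (ridgeResidual k φ σ x z))
          (ridgeEmbedding φ σ x (ridgeEstimate k φ σ x e)) := by
  have hsignal : postMean k σ x (fun i => inner ℝ h (φ (x i))) z =
      inner ℝ h (ridgeEstimate k φ σ x (kvec k x z)) := by
    rw [postMean, hφ.dotProduct_inv_mulVec_comm hσ, ridgeEstimate, inner_sum]
    simp only [dotProduct, real_inner_smul_right, mul_comm]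
  have hlinear : postMean k σ x (fun i => inner ℝ h (φ (x i)) + e i) z =
      postMean k σ x (fun i => inner ℝ h (φ (x i))) z + postMean k σ x e z := by
    simp only [postMean, ← dotProduct_add, ← mulVec_add]
    rfl
  rw [hlinear, hsignal, hφ.inner_ridgeEmbedding_ridgeResidual hσ, hφ.postMean_eq_inner (y := e),
    ridgeResidual, inner_sub_right]
  ring

theorem abs_sub_postMean_le (hφ : IsFeatureMap k φ) (hσ : 0 < σ) (x : Fin n → X)
    (e : Fin n → ℝ) (h : H) (z : X) :
    |inner ℝ h (φ z) - postMean k σ x (fun i => inner ℝ h (φ (x i)) + e i) z| ≤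
      (‖h‖ + √((σ ^ 2)⁻¹ * noiseEnergy k σ x e)) * √(postVar k σ x z) := by
  rw [hφ.sub_postMean_eq hσ, hφ.noiseEnergy_eq_norm_sq hσ, hφ.postVar_eq_norm_sq hσ,
    Real.sqrt_sq (norm_nonneg _), Real.sqrt_sq (norm_nonneg _)]
  set p := ridgeResidual k φ σ x z
  set r := ridgeEstimate k φ σ x e
  calc _ ≤ |inner ℝ h p| + |inner ℝ (ridgeEmbedding φ σ x p) (ridgeEmbedding φ σ x r)| :=
        abs_sub _ _
    _ ≤ ‖h‖ * ‖ridgeEmbedding φ σ x p‖ + ‖ridgeEmbedding φ σ x p‖ * ‖ridgeEmbedding φ σ x r‖ := by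
        gcongr
        · exact (abs_real_inner_le_norm h p).trans
            (by gcongr; exact norm_le_norm_ridgeEmbedding φ σ x p)
        · exact abs_real_inner_le_norm _ _
    _ = _ := by ring

end IsFeatureMap

end Posterior

/-! ### Adding one query -/

section AddQuery

variable {X H : Type*} [NormedAddCommGroup H] [InnerProductSpace ℝ H] {k : X → X → ℝ} {φ : X → H}
  {σ : ℝ} {n : ℕ}

namespace IsFeatureMap

theorem noiseEnergy_eq_sub (hφ : IsFeatureMap k φ) (hσ : 0 < σ) (x : Fin n → X) (e : Fin n → ℝ) :
    noiseEnergy k σ x e = e ⬝ᵥ e - σ ^ 2 * (e ⬝ᵥ (regGram k σ x)⁻¹ *ᵥ e) := by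
  rw [noiseEnergy, hφ.gram_mulVec_inv_mulVec hσ, dotProduct_sub, dotProduct_smul, smul_eq_mul]

theorem regGram_mulVec_snoc (hφ : IsFeatureMap k φ) (x : Fin (n + 1) → X) (u : Fin n → ℝ) (r : ℝ) :
    regGram k σ x *ᵥ (Fin.snoc u r : Fin (n + 1) → ℝ) =
      (Fin.snoc (regGram k σ (Fin.init x) *ᵥ u + r • kvec k (Fin.init x) (x (Fin.last n)))
        (kvec k (Fin.init x) (x (Fin.last n)) ⬝ᵥ u +
          (k (x (Fin.last n)) (x (Fin.last n)) + σ ^ 2) * r) : Fin (n + 1) → ℝ) := by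
  simp only [regGram, add_mulVec, smul_mulVec, one_mulVec]
  refine funext fun j => Fin.lastCases ?_ (fun j => ?_) j
  · simp only [mulVec, dotProduct, gram, of_apply, kvec, Fin.init, Pi.add_apply, Pi.smul_apply,
      Fin.sum_univ_castSucc, Fin.snoc_castSucc, Fin.snoc_last, smul_eq_mul,
      hφ.symm (x (Fin.last n)) (x (Fin.castSucc _))]
    ring
  · simp only [mulVec, dotProduct, gram, of_apply, kvec, Fin.init, Pi.add_apply, Pi.smul_apply,
      Fin.sum_univ_castSucc, Fin.snoc_castSucc, Fin.snoc_last, smul_eq_mul]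
    ring

theorem regGram_inv_mulVec_eq_snoc (hφ : IsFeatureMap k φ) (hσ : 0 < σ) (x : Fin (n + 1) → X)
    (e : Fin (n + 1) → ℝ) {r : ℝ}
    (hr : r = (e (Fin.last n) - postMean k σ (Fin.init x) (Fin.init e) (x (Fin.last n))) /
      (σ ^ 2 + postVar k σ (Fin.init x) (x (Fin.last n)))) :
    (regGram k σ x)⁻¹ *ᵥ e =
      (Fin.snoc ((regGram k σ (Fin.init x))⁻¹ *ᵥ Fin.init e -
        r • (regGram k σ (Fin.init x))⁻¹ *ᵥ kvec k (Fin.init x) (x (Fin.last n))) r :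
          Fin (n + 1) → ℝ) := by
  set z := x (Fin.last n)
  have hV := hφ.postVar_nonneg hσ (Fin.init x : Fin n → X) z
  have hr' : r * (σ ^ 2 + postVar k σ (Fin.init x) z) =
      e (Fin.last n) - postMean k σ (Fin.init x) (Fin.init e) z := by
    rw [hr, div_mul_cancel₀ _ (by positivity)]
  have hsolves : regGram k σ x *ᵥ (Fin.snoc ((regGram k σ (Fin.init x))⁻¹ *ᵥ Fin.init e -
      r • (regGram k σ (Fin.init x))⁻¹ *ᵥ kvec k (Fin.init x) z) r : Fin (n + 1) → ℝ) = e := by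
    rw [hφ.regGram_mulVec_snoc, mulVec_sub, mulVec_smul, hφ.regGram_mulVec_inv_mulVec hσ,
      hφ.regGram_mulVec_inv_mulVec hσ, sub_add_cancel, dotProduct_sub, dotProduct_smul, smul_eq_mul]
    rw [postVar, postMean] at hr'
    conv_rhs => rw [← Fin.snoc_init_self e]
    congr 1
    linarith
  conv_lhs => rw [← hsolves]
  rw [mulVec_mulVec, nonsing_inv_mul _ (hφ.regGram_posDef hσ x).det_pos.ne'.isUnit, one_mulVec]

theorem noiseEnergy_succ (hφ : IsFeatureMap k φ) (hσ : 0 < σ) (x : Fin (n + 1) → X)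
    (e : Fin (n + 1) → ℝ) :
    noiseEnergy k σ x e = noiseEnergy k σ (Fin.init x) (Fin.init e) +
      (e (Fin.last n) ^ 2 -
        (e (Fin.last n) - postMean k σ (Fin.init x) (Fin.init e) (x (Fin.last n))) ^ 2 /
          (1 + (σ ^ 2)⁻¹ * postVar k σ (Fin.init x) (x (Fin.last n)))) := by
  have hV := hφ.postVar_nonneg hσ (Fin.init x : Fin n → X) (x (Fin.last n))
  have hsnoc (u v : Fin n → ℝ) (a b : ℝ) :
      (Fin.snoc u a : Fin (n + 1) → ℝ) ⬝ᵥ (Fin.snoc v b : Fin (n + 1) → ℝ) = u ⬝ᵥ v + a * b := by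
    simp only [dotProduct, Fin.sum_univ_castSucc, Fin.snoc_castSucc, Fin.snoc_last]
  rw [hφ.noiseEnergy_eq_sub hσ, hφ.noiseEnergy_eq_sub hσ,
    hφ.regGram_inv_mulVec_eq_snoc hσ x e rfl]
  nth_rw 1 2 3 [← Fin.snoc_init_self e]
  rw [hsnoc, hsnoc, dotProduct_sub, dotProduct_smul, smul_eq_mul,
    hφ.dotProduct_inv_mulVec_comm hσ (Fin.init x) (Fin.init e) (kvec _ _ _), ← postMean]
  field_simp
  ring

theorem det_regGram_succ (hφ : IsFeatureMap k φ) (hσ : 0 < σ) (x : Fin (n + 1) → X) :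
    (regGram k σ x).det = (regGram k σ (Fin.init x)).det *
      (σ ^ 2 + postVar k σ (Fin.init x) (x (Fin.last n))) := by
  have hV := hφ.postVar_nonneg hσ (Fin.init x : Fin n → X) (x (Fin.last n))
  have hdet := (hφ.regGram_posDef hσ x).det_pos
  have hsolve : (regGram k σ x)⁻¹ (Fin.last n) (Fin.last n) =
      (σ ^ 2 + postVar k σ (Fin.init x) (x (Fin.last n)))⁻¹ := by
    have hsingle_init : Fin.init (Pi.single (Fin.last n) 1 : Fin (n + 1) → ℝ) = 0 :=
      funext fun i => Pi.single_eq_of_ne (Fin.castSucc_lt_last i).ne 1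
    have h := congrFun (hφ.regGram_inv_mulVec_eq_snoc hσ x (Pi.single (Fin.last n) 1) rfl)
      (Fin.last n)
    rwa [Fin.snoc_last, hsingle_init, postMean, mulVec_zero, dotProduct_zero, mulVec_single_one,
      Pi.single_eq_same, sub_zero, one_div] at h
  have hcramer : (regGram k σ x)⁻¹ (Fin.last n) (Fin.last n) =
      (regGram k σ x).det⁻¹ * (regGram k σ (Fin.init x)).det := by
    have hminor : (regGram k σ x).submatrix Fin.castSucc Fin.castSucc =
        regGram k σ (Fin.init x) := by
      ext i j
      simp [regGram, gram, Fin.init, one_apply]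
    rw [inv_def, Ring.inverse_eq_inv', Matrix.smul_apply, adjugate_fin_succ_eq_det_submatrix,
      Fin.succAbove_last, hminor, smul_eq_mul, Even.neg_one_pow ⟨_, rfl⟩, one_mul]
  rw [hsolve] at hcramer
  field_simp at hcramer
  linarith

end IsFeatureMap

end AddQuery

/-! ### Information gain -/

section InfoGain

variable {X H : Type*} [NormedAddCommGroup H] [InnerProductSpace ℝ H] {k : X → X → ℝ} {φ : X → H}
  {σ c : ℝ} {n : ℕ}

/-- The information gain of the queries `x`, whose supremum over the `n`-tuples of queries is
`maxInfoGain k σ n`. -/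
def infoGain (k : X → X → ℝ) (σ : ℝ) (x : Fin n → X) : ℝ :=
  1 / 2 * Real.log (1 + (σ ^ 2)⁻¹ • gram k x).det

namespace IsFeatureMap

theorem gram_isHermitian (hφ : IsFeatureMap k φ) (x : Fin n → X) : (gram k x).IsHermitian :=
  (hφ.gram_posSemidef x).isHermitian

theorem one_le_one_add_eigenvalues (hφ : IsFeatureMap k φ) (σ : ℝ) (x : Fin n → X) (i : Fin n) :
    1 ≤ 1 + (σ ^ 2)⁻¹ * (hφ.gram_isHermitian x).eigenvalues i :=
  le_add_of_nonneg_right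
    (mul_nonneg (by positivity) ((hφ.gram_posSemidef x).eigenvalues_nonneg i))

theorem infoGain_eq_sum (hφ : IsFeatureMap k φ) (σ : ℝ) (x : Fin n → X) :
    infoGain k σ x =
      1 / 2 * ∑ i, Real.log (1 + (σ ^ 2)⁻¹ * (hφ.gram_isHermitian x).eigenvalues i) := by
  rw [infoGain, det_one_add_smul_eq_prod_eigenvalues (hφ.gram_isHermitian x),
    Real.log_prod fun i _ => (one_pos.trans_le (hφ.one_le_one_add_eigenvalues σ x i)).ne']

theorem infoGain_nonneg (hφ : IsFeatureMap k φ) (σ : ℝ) (x : Fin n → X) : 0 ≤ infoGain k σ x := by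
  rw [hφ.infoGain_eq_sum]
  have := Finset.sum_nonneg fun i (_ : i ∈ Finset.univ) =>
    Real.log_nonneg (hφ.one_le_one_add_eigenvalues σ x i)
  positivity

theorem infoGain_succ (hφ : IsFeatureMap k φ) (hσ : 0 < σ) (x : Fin (n + 1) → X) :
    infoGain k σ x = infoGain k σ (Fin.init x) +
      1 / 2 * Real.log (1 + (σ ^ 2)⁻¹ * postVar k σ (Fin.init x) (x (Fin.last n))) := by
  have hdet {m : ℕ} (x : Fin m → X) :
      (1 + (σ ^ 2)⁻¹ • gram k x).det = ((σ ^ 2)⁻¹) ^ m * (regGram k σ x).det := by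
    have hsmul : 1 + (σ ^ 2)⁻¹ • gram k x = (σ ^ 2)⁻¹ • regGram k σ x := by
      rw [regGram, smul_add, inv_smul_smul₀ (by positivity), add_comm]
    rw [hsmul, det_smul, Fintype.card_fin]
  have hV := hφ.postVar_nonneg hσ (Fin.init x : Fin n → X) (x (Fin.last n))
  have hpos := (hφ.regGram_posDef hσ (Fin.init x : Fin n → X)).det_pos
  rw [infoGain, infoGain, ← mul_add, ← Real.log_mul (by rw [hdet]; positivity) (by positivity),
    hdet, hdet, hφ.det_regGram_succ hσ, pow_succ]
  congr 2
  field_simp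

theorem infoGain_le (hφ : IsFeatureMap k φ) (hk : ∀ z, k z z ≤ c) (σ : ℝ) (x : Fin n → X) :
    infoGain k σ x ≤ 1 / 2 * ((σ ^ 2)⁻¹ * (n * c)) := by
  have htrace : ∑ i, (hφ.gram_isHermitian x).eigenvalues i ≤ n * c := by
    have htrace_eq := (hφ.gram_isHermitian x).trace_eq_sum_eigenvalues
    simp only [RCLike.ofReal_real_eq_id, id] at htrace_eq
    rw [← htrace_eq, trace]
    exact (Finset.sum_le_card_nsmul _ _ c fun i _ => hk (x i)).trans_eq (by simp)
  rw [hφ.infoGain_eq_sum]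
  gcongr
  calc ∑ i, Real.log (1 + (σ ^ 2)⁻¹ * (hφ.gram_isHermitian x).eigenvalues i)
      ≤ ∑ i, (σ ^ 2)⁻¹ * (hφ.gram_isHermitian x).eigenvalues i := by
        gcongr with i
        linarith [Real.log_le_sub_one_of_pos
          (one_pos.trans_le (hφ.one_le_one_add_eigenvalues σ x i))]
    _ = (σ ^ 2)⁻¹ * ∑ i, (hφ.gram_isHermitian x).eigenvalues i := by rw [Finset.mul_sum]
    _ ≤ (σ ^ 2)⁻¹ * (n * c) := by gcongr

theorem infoGain_le_maxInfoGain (hφ : IsFeatureMap k φ) (hk : ∀ z, k z z ≤ c) (σ : ℝ)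
    (x : Fin n → X) : infoGain k σ x ≤ maxInfoGain k σ n :=
  le_ciSup (f := infoGain k σ)
    ⟨1 / 2 * ((σ ^ 2)⁻¹ * (n * c)), Set.forall_mem_range.2 fun A => hφ.infoGain_le hk σ A⟩ x

theorem infoGain_le_maxInfoGain_succ (hφ : IsFeatureMap k φ) (hk : ∀ z, k z z ≤ c) (hσ : 0 < σ)
    (x : Fin n → X) (z : X) : infoGain k σ x ≤ maxInfoGain k σ (n + 1) := by
  refine le_trans ?_ (hφ.infoGain_le_maxInfoGain hk σ (Fin.snoc (α := fun _ => X) x z))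
  have hV := hφ.postVar_nonneg hσ x z
  rw [hφ.infoGain_succ hσ, Fin.init_snoc, Fin.snoc_last]
  have := Real.log_nonneg
    (le_add_of_nonneg_right (a := (1 : ℝ)) (b := (σ ^ 2)⁻¹ * postVar k σ x z) (by positivity))
  linarith

theorem maxInfoGain_nonneg (hφ : IsFeatureMap k φ) (σ : ℝ) (n : ℕ) : 0 ≤ maxInfoGain k σ n :=
  Real.iSup_nonneg fun A => hφ.infoGain_nonneg σ A

theorem eigenvalues_le (hφ : IsFeatureMap k φ) (hσ : 0 < σ) (x : Fin n → X) (i : Fin n) :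
    (hφ.gram_isHermitian x).eigenvalues i ≤ σ ^ 2 * (Real.exp (2 * infoGain k σ x) - 1) := by
  have hlog : Real.log (1 + (σ ^ 2)⁻¹ * (hφ.gram_isHermitian x).eigenvalues i) ≤
      2 * infoGain k σ x := by
    have := Finset.single_le_sum (fun j _ => Real.log_nonneg (hφ.one_le_one_add_eigenvalues σ x j))
      (Finset.mem_univ i)
    linarith [hφ.infoGain_eq_sum σ x]
  have hexp := (Real.log_le_iff_le_exp
    (one_pos.trans_le (hφ.one_le_one_add_eigenvalues σ x i))).1 hlog
  rw [← inv_mul_le_iff₀ (by positivity)]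
  linarith

end IsFeatureMap

end InfoGain

/-! ### Sub-Gaussian noise -/

theorem lintegral_mul_ofReal_le_of_condExp_le {Ω : Type*} {m mΩ : MeasurableSpace Ω}
    {P : Measure Ω} [IsFiniteMeasure P] (hm : m ≤ mΩ) {w : Ω → ℝ} (hw : Integrable w P)
    (hw0 : 0 ≤ w) {c : ℝ} (hc : 0 ≤ c) (hwc : P[w | m] ≤ᵐ[P] fun _ => c) {g : Ω → ℝ≥0∞}
    (hg : Measurable[m] g) :
    ∫⁻ ω, g ω * ENNReal.ofReal (w ω) ∂P ≤ ENNReal.ofReal c * ∫⁻ ω, g ω ∂P := by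
  set ν := P.withDensity fun ω => ENNReal.ofReal (w ω)
  have hν : ν.trim hm ≤ ENNReal.ofReal c • P.trim hm := by
    refine Measure.le_iff.2 fun s hs => ?_
    rw [trim_measurableSet_eq hm hs, Measure.smul_apply, trim_measurableSet_eq hm hs,
      withDensity_apply _ (hm s hs), ← ofReal_integral_eq_lintegral_ofReal hw.integrableOn
        (ae_of_all _ hw0), ← setIntegral_condExp hm hw hs, smul_eq_mul]
    calc ENNReal.ofReal (∫ ω in s, (P[w | m]) ω ∂P) ≤ ENNReal.ofReal (∫ _ in s, c ∂P) :=
          ENNReal.ofReal_le_ofReal (integral_mono_ae integrable_condExp.integrableOn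
            (integrable_const c) (ae_restrict_of_ae hwc))
      _ = ENNReal.ofReal c * P s := by
          rw [setIntegral_const, smul_eq_mul, mul_comm, ENNReal.ofReal_mul hc, ofReal_measureReal]
  calc ∫⁻ ω, g ω * ENNReal.ofReal (w ω) ∂P = ∫⁻ ω, g ω ∂ν := by
        rw [lintegral_withDensity_eq_lintegral_mul₀ hw.1.aemeasurable.ennreal_ofReal
          (hg.mono hm le_rfl).aemeasurable]
        simp only [Pi.mul_apply, mul_comm]
    _ = ∫⁻ ω, g ω ∂ν.trim hm := (lintegral_trim hm hg).symm
    _ ≤ ∫⁻ ω, g ω ∂(ENNReal.ofReal c • P.trim hm) := lintegral_mono' hν le_rfl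
    _ = ENNReal.ofReal c * ∫⁻ ω, g ω ∂P := by
        rw [lintegral_smul_measure, lintegral_trim hm hg, smul_eq_mul]

theorem lintegral_exp_gaussianReal {a : ℝ} (ha : 0 ≤ a) (b : ℝ) :
    ∫⁻ u, ENNReal.ofReal (Real.exp (b * u - a * u ^ 2 / 2)) ∂gaussianReal 0 1 =
      ENNReal.ofReal (Real.exp (b ^ 2 / (2 * (1 + a)) - 1 / 2 * Real.log (1 + a))) := by
  have ha1 : 0 < 1 + a := by positivity
  obtain ⟨v, hv⟩ : ∃ v : NNReal, (v : ℝ) = (1 + a)⁻¹ := ⟨⟨_, (inv_pos.2 ha1).le⟩, rfl⟩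
  have hv0 : v ≠ 0 := NNReal.coe_ne_zero.1 (hv ▸ (inv_pos.2 ha1).ne')
  have hdensity (u : ℝ) :
      gaussianPDF 0 1 u * ENNReal.ofReal (Real.exp (b * u - a * u ^ 2 / 2)) =
        ENNReal.ofReal (Real.exp (b ^ 2 / (2 * (1 + a)) - 1 / 2 * Real.log (1 + a))) *
          gaussianPDF (b / (1 + a)) v u := by
    have hsqrt : √(2 * Real.pi * v) = √(2 * Real.pi) * (√(1 + a))⁻¹ := by
      rw [hv, Real.sqrt_mul (by positivity), Real.sqrt_inv]
    have hlog : Real.exp (-(1 / 2 * Real.log (1 + a))) = (√(1 + a))⁻¹ := by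
      rw [Real.exp_neg, Real.sqrt_eq_rpow, Real.rpow_def_of_pos ha1, mul_comm]
    have hexponent : -(u - 0) ^ 2 / (2 * (1 : NNReal)) + (b * u - a * u ^ 2 / 2) =
        b ^ 2 / (2 * (1 + a)) + -(u - b / (1 + a)) ^ 2 / (2 * v) := by
      rw [hv, NNReal.coe_one]
      field_simp
      ring
    rw [gaussianPDF, gaussianPDF, ← ENNReal.ofReal_mul (gaussianPDFReal_nonneg _ _ _),
      ← ENNReal.ofReal_mul (Real.exp_pos _).le, gaussianPDFReal, gaussianPDFReal, mul_assoc,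
      ← Real.exp_add, hexponent, sub_eq_add_neg (b ^ 2 / _), Real.exp_add, Real.exp_add, hlog,
      hsqrt, NNReal.coe_one, mul_one]
    congr 1
    field_simp
  rw [gaussianReal_of_var_ne_zero 0 one_ne_zero,
    lintegral_withDensity_eq_lintegral_mul _ (measurable_gaussianPDF 0 1) (by fun_prop)]
  simp only [Pi.mul_apply, hdensity]
  rw [lintegral_const_mul _ (measurable_gaussianPDF _ _), lintegral_gaussianPDF_eq_one _ hv0,
    mul_one]

theorem lintegral_exp_multiplier_gaussianReal {R : ℝ} (hR : 0 < R) {v : ℝ} (hv : 0 ≤ v) (a b : ℝ) :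
    ∫⁻ u, ENNReal.ofReal (Real.exp ((a + R * √v * u) / R ^ 2 * b -
        ((a + R * √v * u) / R ^ 2) ^ 2 * R ^ 2 / 2)) ∂gaussianReal 0 1 =
      ENNReal.ofReal (Real.exp
        ((b ^ 2 - (b - a) ^ 2 / (1 + v)) / (2 * R ^ 2) - 1 / 2 * Real.log (1 + v))) := by
  have hsq := Real.sq_sqrt hv
  have hexponent (u : ℝ) : (a + R * √v * u) / R ^ 2 * b -
      ((a + R * √v * u) / R ^ 2) ^ 2 * R ^ 2 / 2 =
        (2 * a * b - a ^ 2) / (2 * R ^ 2) + (√v * (b - a) / R * u - v * u ^ 2 / 2) := by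
    rw [← hsq, Real.sqrt_sq (Real.sqrt_nonneg _)]
    field_simp
    ring
  have htotal : (b ^ 2 - (b - a) ^ 2 / (1 + v)) / (2 * R ^ 2) =
      (2 * a * b - a ^ 2) / (2 * R ^ 2) + (√v * (b - a) / R) ^ 2 / (2 * (1 + v)) := by
    rw [div_pow, mul_pow, hsq]
    field_simp
    ring
  simp only [hexponent, Real.exp_add, ENNReal.ofReal_mul (Real.exp_pos _).le]
  rw [lintegral_const_mul _ (by fun_prop), lintegral_exp_gaussianReal hv, htotal, add_sub_assoc,
    Real.exp_add, ENNReal.ofReal_mul (Real.exp_pos _).le]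

namespace CondSubGaussian

variable {Ω : Type*} {m mΩ : MeasurableSpace Ω} {P : Measure Ω} {e : Ω → ℝ} {R R' : ℝ}

theorem mono (he : CondSubGaussian P m R e) (hR : |R| ≤ R') : CondSubGaussian P m R' e := by
  refine fun η => ⟨(he η).1, (he η).2.trans (ae_of_all _ fun ω => ?_)⟩
  have : R ^ 2 ≤ R' ^ 2 := sq_le_sq' (neg_le_of_abs_le hR) (le_of_abs_le hR)
  dsimp only
  gcongr

variable [IsFiniteMeasure P]

theorem lintegral_mul_exp_const_le (he : CondSubGaussian P m R e) (hm : m ≤ mΩ) (η : ℝ)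
    {g : Ω → ℝ≥0∞} (hg : Measurable[m] g) :
    ∫⁻ ω, g ω * ENNReal.ofReal (Real.exp (η * e ω - η ^ 2 * R ^ 2 / 2)) ∂P ≤
      ∫⁻ ω, g ω ∂P := by
  set c := η ^ 2 * R ^ 2 / 2
  have hsplit (ω : Ω) : g ω * ENNReal.ofReal (Real.exp (η * e ω - c)) =
      ENNReal.ofReal (Real.exp (-c)) * (g ω * ENNReal.ofReal (Real.exp (η * e ω))) := by
    rw [sub_eq_neg_add, Real.exp_add, ENNReal.ofReal_mul (Real.exp_pos _).le, mul_left_comm]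
  simp only [hsplit]
  rw [lintegral_const_mul' _ _ ENNReal.ofReal_ne_top]
  calc _ ≤ ENNReal.ofReal (Real.exp (-c)) * (ENNReal.ofReal (Real.exp c) * ∫⁻ ω, g ω ∂P) := by
        gcongr
        exact lintegral_mul_ofReal_le_of_condExp_le hm (he η).1 (fun ω => (Real.exp_pos _).le)
          (Real.exp_pos _).le (he η).2 hg
    _ = ∫⁻ ω, g ω ∂P := by
        rw [← mul_assoc, ← ENNReal.ofReal_mul (Real.exp_pos _).le, ← Real.exp_add, neg_add_cancel,
          Real.exp_zero, ENNReal.ofReal_one, one_mul]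

theorem lintegral_mul_exp_simpleFunc_le (he : CondSubGaussian P m R e) (hm : m ≤ mΩ)
    (ξ : @SimpleFunc Ω m ℝ) {g : Ω → ℝ≥0∞} (hg : Measurable[m] g) :
    ∫⁻ ω, g ω * ENNReal.ofReal (Real.exp (ξ ω * e ω - ξ ω ^ 2 * R ^ 2 / 2)) ∂P ≤
      ∫⁻ ω, g ω ∂P := by
  classical
  induction ξ using SimpleFunc.induction' generalizing g with
  | const η => exact he.lintegral_mul_exp_const_le hm η hg
  | pcw hs hξ₁ hξ₂ =>
    have hlocal {ξ : Ω → ℝ} {A : Set Ω} (hA : MeasurableSet[m] A)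
        (hξ : ∀ {g : Ω → ℝ≥0∞}, Measurable[m] g →
          ∫⁻ ω, g ω * ENNReal.ofReal (Real.exp (ξ ω * e ω - ξ ω ^ 2 * R ^ 2 / 2)) ∂P ≤
            ∫⁻ ω, g ω ∂P) :
        ∫⁻ ω in A, g ω * ENNReal.ofReal (Real.exp (ξ ω * e ω - ξ ω ^ 2 * R ^ 2 / 2)) ∂P ≤
          ∫⁻ ω in A, g ω ∂P := by
      rw [← lintegral_indicator (hm _ hA), ← lintegral_indicator (hm _ hA)]
      simpa only [Set.indicator_mul_left] using hξ (hg.indicator hA)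
    rw [← lintegral_add_compl _ (hm _ hs), ← lintegral_add_compl g (hm _ hs)]
    refine add_le_add (le_trans (le_of_eq ?_) (hlocal hs hξ₁))
      (le_trans (le_of_eq ?_) (hlocal hs.compl hξ₂))
    · exact setLIntegral_congr_fun (hm _ hs) fun ω hω => by
        simp only [SimpleFunc.coe_piecewise, Set.piecewise_eq_of_mem _ _ _ hω]
    · exact setLIntegral_congr_fun (hm _ hs.compl) fun ω hω => by
        simp only [SimpleFunc.coe_piecewise, Set.piecewise_eq_of_notMem _ _ _ hω]

theorem lintegral_mul_exp_le (he : CondSubGaussian P m R e) (hm : m ≤ mΩ) (hme : Measurable e)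
    {ζ : Ω → ℝ} (hζ : Measurable[m] ζ) {g : Ω → ℝ≥0∞} (hg : Measurable[m] g) :
    ∫⁻ ω, g ω * ENNReal.ofReal (Real.exp (ζ ω * e ω - ζ ω ^ 2 * R ^ 2 / 2)) ∂P ≤
      ∫⁻ ω, g ω ∂P := by
  set ξ : ℕ → @SimpleFunc Ω m ℝ := hζ.stronglyMeasurable.approx
  set F : ℝ → Ω → ℝ≥0∞ :=
    fun η ω => g ω * ENNReal.ofReal (Real.exp (η * e ω - η ^ 2 * R ^ 2 / 2))
  have hF_meas (n : ℕ) : Measurable fun ω => F (ξ n ω) ω := by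
    have hξ : Measurable (ξ n) := (@SimpleFunc.measurable Ω ℝ m _ (ξ n)).mono hm le_rfl
    have hg' : Measurable g := hg.mono hm le_rfl
    fun_prop
  have hF_lim (ω : Ω) : Filter.Tendsto (fun n => F (ξ n ω) ω) Filter.atTop (nhds (F (ζ ω) ω)) := by
    have hcont : Continuous fun η => Real.exp (η * e ω - η ^ 2 * R ^ 2 / 2) := by fun_prop
    exact ENNReal.Tendsto.const_mul (ENNReal.tendsto_ofReal ((hcont.tendsto _).comp
      (hζ.stronglyMeasurable.tendsto_approx ω)))
      (Or.inl (ENNReal.ofReal_pos.2 (Real.exp_pos _)).ne')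
  calc ∫⁻ ω, F (ζ ω) ω ∂P = ∫⁻ ω, Filter.liminf (fun n => F (ξ n ω) ω) Filter.atTop ∂P :=
        lintegral_congr fun ω => (hF_lim ω).liminf_eq.symm
    _ ≤ Filter.liminf (fun n => ∫⁻ ω, F (ξ n ω) ω ∂P) Filter.atTop := lintegral_liminf_le hF_meas
    _ ≤ Filter.liminf (fun _ : ℕ => ∫⁻ ω, g ω ∂P) Filter.atTop :=
        Filter.liminf_le_liminf (Filter.Eventually.of_forall fun n =>
          he.lintegral_mul_exp_simpleFunc_le hm (ξ n) hg)
    _ = ∫⁻ ω, g ω ∂P := Filter.liminf_const _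

theorem lintegral_mul_exp_mixture_le (he : CondSubGaussian P m R e) (hR : 0 < R) (hm : m ≤ mΩ)
    (hme : Measurable e) {μ V : Ω → ℝ} (hμ : Measurable[m] μ) (hV : Measurable[m] V) (hV0 : 0 ≤ V)
    {g : Ω → ℝ≥0∞} (hg : Measurable[m] g) :
    ∫⁻ ω, g ω * ENNReal.ofReal (Real.exp
        ((e ω ^ 2 - (e ω - μ ω) ^ 2 / (1 + V ω)) / (2 * R ^ 2) - 1 / 2 * Real.log (1 + V ω))) ∂P ≤
      ∫⁻ ω, g ω ∂P := by
  set ζ : ℝ → Ω → ℝ := fun u ω => (μ ω + R * √(V ω) * u) / R ^ 2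
  set F : Ω → ℝ → ℝ≥0∞ :=
    fun ω u => g ω * ENNReal.ofReal (Real.exp (ζ u ω * e ω - ζ u ω ^ 2 * R ^ 2 / 2))
  have hmixture (ω : Ω) : ∫⁻ u, F ω u ∂gaussianReal 0 1 = g ω * ENNReal.ofReal (Real.exp
      ((e ω ^ 2 - (e ω - μ ω) ^ 2 / (1 + V ω)) / (2 * R ^ 2) - 1 / 2 * Real.log (1 + V ω))) := by
    rw [lintegral_const_mul _ (by fun_prop), lintegral_exp_multiplier_gaussianReal hR (hV0 ω)]
  have hζ_meas (u : ℝ) : Measurable[m] (ζ u) :=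
    (hμ.add ((hV.sqrt.const_mul R).mul_const u)).div_const _
  have hF_meas : Measurable (Function.uncurry F) := by
    have hμ' : Measurable μ := hμ.mono hm le_rfl
    have hV' : Measurable V := hV.mono hm le_rfl
    have hg' : Measurable g := hg.mono hm le_rfl
    fun_prop
  simp only [← hmixture]
  calc ∫⁻ ω, ∫⁻ u, F ω u ∂gaussianReal 0 1 ∂P = ∫⁻ u, ∫⁻ ω, F ω u ∂P ∂gaussianReal 0 1 :=
        lintegral_lintegral_swap hF_meas.aemeasurable
    _ ≤ ∫⁻ _, ∫⁻ ω, g ω ∂P ∂gaussianReal 0 1 :=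
        lintegral_mono fun u => he.lintegral_mul_exp_le hm hme (hζ_meas u) hg
    _ = ∫⁻ ω, g ω ∂P := by rw [lintegral_const, measure_univ, mul_one]

end CondSubGaussian

/-! ### Measurability -/

section Measurability

variable {Ω X ι : Type*} {mΩ : MeasurableSpace Ω} [MeasurableSpace X] [Fintype ι]
  {k : X → X → ℝ} {n : ℕ} {x : Ω → Fin n → X}

theorem measurable_dotProduct {u v : Ω → ι → ℝ} (hu : Measurable u) (hv : Measurable v) :
    Measurable fun ω => u ω ⬝ᵥ v ω := by
  simp only [dotProduct]
  fun_prop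

theorem measurable_mulVec {A : Ω → Matrix ι ι ℝ} (hA : ∀ i j, Measurable fun ω => A ω i j)
    {v : Ω → ι → ℝ} (hv : Measurable v) : Measurable fun ω => A ω *ᵥ v ω :=
  measurable_pi_lambda _ fun i => measurable_dotProduct (measurable_pi_lambda _ (hA i)) hv

variable [DecidableEq ι]

theorem measurable_matrix_det {A : Ω → Matrix ι ι ℝ} (hA : ∀ i j, Measurable fun ω => A ω i j) :
    Measurable fun ω => (A ω).det := by
  simp only [det_apply']
  fun_prop

theorem measurable_matrix_inv_apply {A : Ω → Matrix ι ι ℝ}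
    (hA : ∀ i j, Measurable fun ω => A ω i j) (i j : ι) : Measurable fun ω => (A ω)⁻¹ i j := by
  simp only [inv_def, Matrix.smul_apply, adjugate_apply, Ring.inverse_eq_inv', smul_eq_mul]
  refine (measurable_matrix_det hA).inv.mul (measurable_matrix_det fun a b => ?_)
  simp only [updateRow_apply]
  split_ifs
  exacts [measurable_const, hA a b]

theorem measurable_gram_apply (hk : Measurable (Function.uncurry k)) (hx : Measurable x)
    (i j : Fin n) : Measurable fun ω => gram k (x ω) i j :=
  hk.comp ((measurable_pi_iff.1 hx i).prodMk (measurable_pi_iff.1 hx j))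

theorem measurable_kvec (hk : Measurable (Function.uncurry k)) (hx : Measurable x) {z : Ω → X}
    (hz : Measurable z) : Measurable fun ω => kvec k (x ω) (z ω) :=
  measurable_pi_lambda _ fun i => hk.comp ((measurable_pi_iff.1 hx i).prodMk hz)

theorem measurable_regGram_inv_mulVec (hk : Measurable (Function.uncurry k)) (σ : ℝ)
    (hx : Measurable x) {y : Ω → Fin n → ℝ} (hy : Measurable y) :
    Measurable fun ω => (regGram k σ (x ω))⁻¹ *ᵥ y ω :=
  measurable_mulVec (measurable_matrix_inv_apply fun i j =>
    (measurable_gram_apply hk hx i j).add_const _) hy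

theorem measurable_postMean (hk : Measurable (Function.uncurry k)) (σ : ℝ) (hx : Measurable x)
    {y : Ω → Fin n → ℝ} (hy : Measurable y) {z : Ω → X} (hz : Measurable z) :
    Measurable fun ω => postMean k σ (x ω) (y ω) (z ω) :=
  measurable_dotProduct (measurable_kvec hk hx hz) (measurable_regGram_inv_mulVec hk σ hx hy)

theorem measurable_postVar (hk : Measurable (Function.uncurry k)) (σ : ℝ) (hx : Measurable x)
    {z : Ω → X} (hz : Measurable z) : Measurable fun ω => postVar k σ (x ω) (z ω) :=
  (hk.comp (hz.prodMk hz)).sub (measurable_postMean hk σ hx (measurable_kvec hk hx hz) hz)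

theorem measurable_noiseEnergy (hk : Measurable (Function.uncurry k)) (σ : ℝ) (hx : Measurable x)
    {e : Ω → Fin n → ℝ} (he : Measurable e) : Measurable fun ω => noiseEnergy k σ (x ω) (e ω) :=
  measurable_dotProduct he
    (measurable_mulVec (measurable_gram_apply hk hx) (measurable_regGram_inv_mulVec hk σ hx he))

theorem measurable_infoGain (hk : Measurable (Function.uncurry k)) (σ : ℝ) (hx : Measurable x) :
    Measurable fun ω => infoGain k σ (x ω) :=
  (measurable_matrix_det fun i j => ((measurable_gram_apply hk hx i j).const_mul _).const_add
    _).log.const_mul _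

end Measurability

/-! ### The exponential supermartingale -/

section Supermartingale

variable {X H : Type*} [NormedAddCommGroup H] [InnerProductSpace ℝ H] {k : X → X → ℝ} {φ : X → H}
  {σ τ : ℝ} {n : ℕ}

/-- The logarithm of the mixture supermartingale for `σ`-sub-Gaussian noise `e` at the queries `x`.
The regularization `τ` is that of the Gaussian mixing distribution and need not be `σ`. -/
def logMixture (k : X → X → ℝ) (σ τ : ℝ) (x : Fin n → X) (e : Fin n → ℝ) : ℝ :=
  noiseEnergy k τ x e / (2 * σ ^ 2) - infoGain k τ x

theorem measurable_logMixture [MeasurableSpace X] {Ω : Type*} {_ : MeasurableSpace Ω}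
    (hk : Measurable (Function.uncurry k)) (σ τ : ℝ) {x : Ω → Fin n → X} (hx : Measurable x)
    {e : Ω → Fin n → ℝ} (he : Measurable e) : Measurable fun ω => logMixture k σ τ (x ω) (e ω) :=
  ((measurable_noiseEnergy hk τ hx he).div_const _).sub (measurable_infoGain hk τ hx)

theorem IsFeatureMap.logMixture_succ (hφ : IsFeatureMap k φ) (σ : ℝ) (hτ : 0 < τ)
    (x : Fin (n + 1) → X) (e : Fin (n + 1) → ℝ) :
    logMixture k σ τ x e = logMixture k σ τ (Fin.init x) (Fin.init e) +
      ((e (Fin.last n) ^ 2 -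
        (e (Fin.last n) - postMean k τ (Fin.init x) (Fin.init e) (x (Fin.last n))) ^ 2 /
          (1 + (τ ^ 2)⁻¹ * postVar k τ (Fin.init x) (x (Fin.last n)))) / (2 * σ ^ 2) -
        1 / 2 * Real.log (1 + (τ ^ 2)⁻¹ * postVar k τ (Fin.init x) (x (Fin.last n)))) := by
  rw [logMixture, logMixture, hφ.noiseEnergy_succ hτ, hφ.infoGain_succ hτ]
  ring

variable {Ω : Type*} {mΩ : MeasurableSpace Ω}

theorem measurable_past {α : Type*} [MeasurableSpace α] {u : ℕ → Ω → α} {m : MeasurableSpace Ω}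
    {t : ℕ} (hu : ∀ s ∈ Set.Ico 1 t, Measurable[m] (u s)) :
    Measurable[m] fun ω => past (fun s => u s ω) t :=
  @measurable_pi_lambda _ _ _ m _ _ fun i => hu (i + 1) ⟨by omega, by omega⟩

theorem IsFeatureMap.lintegral_exp_logMixture_le [MeasurableSpace X] {P : Measure Ω}
    [IsProbabilityMeasure P] {ℱ : Filtration ℕ mΩ} {x : ℕ → Ω → X} {ε : ℕ → Ω → ℝ}
    (hφ : IsFeatureMap k φ) (hk : Measurable (Function.uncurry k)) (hσ : 0 < σ) (hτ : 0 < τ) {t : ℕ}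
    (hx : ∀ s ∈ Set.Ico 1 t, Measurable[ℱ (s - 1)] (x s))
    (hε_meas : ∀ s ∈ Set.Ico 1 t, Measurable[ℱ s] (ε s))
    (hε : ∀ s ∈ Set.Ico 1 t, CondSubGaussian P (ℱ (s - 1)) σ (ε s)) :
    ∫⁻ ω, ENNReal.ofReal (Real.exp
      (logMixture k σ τ (past (fun s => x s ω) t) (past (fun s => ε s ω) t))) ∂P ≤ 1 := by
  rcases t with _ | t
  · simp [logMixture, noiseEnergy, infoGain, dotProduct]
  induction t with
  | zero => simp [logMixture, noiseEnergy, infoGain, dotProduct]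
  | succ n ih =>
    have hlast : n + 1 ∈ Set.Ico 1 (n + 2) := ⟨by omega, by omega⟩
    have hpast : Set.Ico 1 (n + 1) ⊆ Set.Ico 1 (n + 2) := Set.Ico_subset_Ico_right (by omega)
    have hxn : Measurable[ℱ n] fun ω => past (fun s => x s ω) (n + 1) :=
      measurable_past fun s hs => (hx s (hpast hs)).mono (ℱ.mono (by grind)) le_rfl
    have hεn : Measurable[ℱ n] fun ω => past (fun s => ε s ω) (n + 1) :=
      measurable_past fun s hs => (hε_meas s (hpast hs)).mono (ℱ.mono (by grind)) le_rfl
    have hxl : Measurable[ℱ n] (x (n + 1)) := hx (n + 1) hlast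
    have hincrement := (hε (n + 1) hlast).lintegral_mul_exp_mixture_le hσ (ℱ.le n)
      ((hε_meas (n + 1) hlast).mono (ℱ.le _) le_rfl) (measurable_postMean hk τ hxn hεn hxl)
      ((measurable_postVar hk τ hxn hxl).const_mul (τ ^ 2)⁻¹)
      (fun ω => mul_nonneg (by positivity) (hφ.postVar_nonneg hτ _ _))
      (measurable_logMixture hk σ τ hxn hεn).exp.ennreal_ofReal
    refine le_trans (le_of_eq (lintegral_congr fun ω => ?_)) (hincrement.trans
      (ih (fun s hs => hx s (hpast hs)) (fun s hs => hε_meas s (hpast hs))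
        fun s hs => hε s (hpast hs)))
    rw [← ENNReal.ofReal_mul (Real.exp_pos _).le, ← Real.exp_add]
    exact congrArg (fun a => ENNReal.ofReal (Real.exp a)) (hφ.logMixture_succ σ hτ
      (past (fun s => x s ω) (n + 2)) (past (fun s => ε s ω) (n + 2)))

end Supermartingale

/-! ### Confidence -/

theorem measure_exists_inv_le_le {ι Ω : Type*} {mΩ : MeasurableSpace Ω} {P : Measure Ω}
    {s : Finset ι} {M : ι → Ω → ℝ≥0∞} (hM : ∀ i ∈ s, AEMeasurable (M i) P)
    (hM_le : ∀ i ∈ s, ∫⁻ ω, M i ω ∂P ≤ 1) (c : ι → ℝ≥0∞) :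
    P {ω | ∃ i ∈ s, (c i)⁻¹ ≤ M i ω} ≤ ∑ i ∈ s, c i := by
  have hunion : {ω | ∃ i ∈ s, (c i)⁻¹ ≤ M i ω} = ⋃ i ∈ s, {ω | (c i)⁻¹ ≤ M i ω} := by
    ext ω
    simp only [Set.mem_ofPred_eq, Set.mem_iUnion, exists_prop]
  rw [hunion]
  refine (measure_biUnion_finset_le s _).trans (Finset.sum_le_sum fun i hi => ?_)
  have hmarkov := (mul_meas_ge_le_lintegral₀ (hM i hi) (c i)⁻¹).trans (hM_le i hi)
  rw [mul_comm] at hmarkov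
  simpa only [inv_inv] using ENNReal.le_inv_iff_mul_le.2 hmarkov

theorem sum_inv_sq_le_one (T : ℕ) : ∑ t ∈ Finset.Icc 2 T, ((t : ℝ) ^ 2)⁻¹ ≤ 1 := by
  have h := sum_Ioo_inv_sq_le (α := ℝ) 1 (T + 1)
  have hset : Finset.Ioo 1 (T + 1) = Finset.Icc 2 T := by grind
  rw [hset] at h
  exact h.trans_eq (by norm_num)

theorem IsFeatureMap.measure_exists_two_mul_log_le_logMixture_le {X H Ω : Type*}
    [MeasurableSpace X] [NormedAddCommGroup H] [InnerProductSpace ℝ H] {k : X → X → ℝ} {φ : X → H}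
    {σ δ : ℝ} {τ : ℕ → ℝ} {mΩ : MeasurableSpace Ω} {P : Measure Ω} [IsProbabilityMeasure P]
    {ℱ : Filtration ℕ mΩ} {x : ℕ → Ω → X} {ε : ℕ → Ω → ℝ} {T : ℕ}
    (hφ : IsFeatureMap k φ) (hk : Measurable (Function.uncurry k)) (hσ : 0 < σ) (hτ : ∀ t, 0 < τ t)
    (hδ : 0 < δ) (hx : ∀ s ∈ Set.Icc 1 T, Measurable[ℱ (s - 1)] (x s))
    (hε_meas : ∀ s ∈ Set.Icc 1 T, Measurable[ℱ s] (ε s))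
    (hε : ∀ s ∈ Set.Icc 1 T, CondSubGaussian P (ℱ (s - 1)) σ (ε s)) :
    P {ω | ∃ t ∈ Finset.Icc 2 T, 2 * Real.log (t / δ) ≤
      logMixture k σ (τ t) (past (fun s => x s ω) t) (past (fun s => ε s ω) t)} ≤
      ENNReal.ofReal (δ ^ 2) := by
  set M : ℕ → Ω → ℝ≥0∞ := fun t ω => ENNReal.ofReal (Real.exp
    (logMixture k σ (τ t) (past (fun s => x s ω) t) (past (fun s => ε s ω) t)))
  have hpast {t : ℕ} (ht : t ∈ Finset.Icc 2 T) : Set.Ico 1 t ⊆ Set.Icc 1 T := fun s hs =>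
    ⟨hs.1, hs.2.le.trans (Finset.mem_Icc.1 ht).2⟩
  have hM (t : ℕ) (ht : t ∈ Finset.Icc 2 T) : Measurable (M t) :=
    (measurable_logMixture hk σ (τ t)
      (measurable_past fun s hs => (hx s (hpast ht hs)).mono (ℱ.le _) le_rfl)
      (measurable_past fun s hs =>
        (hε_meas s (hpast ht hs)).mono (ℱ.le _) le_rfl)).exp.ennreal_ofReal
  have hM_le (t : ℕ) (ht : t ∈ Finset.Icc 2 T) : ∫⁻ ω, M t ω ∂P ≤ 1 :=
    hφ.lintegral_exp_logMixture_le hk hσ (hτ t) (fun s hs => hx s (hpast ht hs))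
      (fun s hs => hε_meas s (hpast ht hs)) fun s hs => hε s (hpast ht hs)
  have hlevel {t : ℕ} (ht : t ∈ Finset.Icc 2 T) :
      (ENNReal.ofReal ((δ / t) ^ 2))⁻¹ = ENNReal.ofReal (Real.exp (2 * Real.log (t / δ))) := by
    have ht0 : (0 : ℝ) < t := by exact_mod_cast (by grind : 0 < t)
    rw [← ENNReal.ofReal_inv_of_pos (by positivity), ← inv_pow, inv_div, mul_comm,
      Real.exp_mul, Real.exp_log (by positivity), Real.rpow_two]
  calc P {ω | ∃ t ∈ Finset.Icc 2 T, _} ≤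
      P {ω | ∃ t ∈ Finset.Icc 2 T, (ENNReal.ofReal ((δ / t) ^ 2))⁻¹ ≤ M t ω} :=
        measure_mono fun ω ⟨t, ht, hle⟩ =>
          ⟨t, ht, hlevel ht ▸ ENNReal.ofReal_le_ofReal (Real.exp_le_exp.2 hle)⟩
    _ ≤ ∑ t ∈ Finset.Icc 2 T, ENNReal.ofReal ((δ / t) ^ 2) :=
        measure_exists_inv_le_le (fun t ht => (hM t ht).aemeasurable) hM_le _
    _ = ENNReal.ofReal (δ ^ 2 * ∑ t ∈ Finset.Icc 2 T, ((t : ℝ) ^ 2)⁻¹) := by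
        rw [← ENNReal.ofReal_sum_of_nonneg fun t _ => by positivity, Finset.mul_sum]
        simp only [div_eq_mul_inv, mul_pow, inv_pow]
    _ ≤ ENNReal.ofReal (δ ^ 2) :=
        ENNReal.ofReal_le_ofReal (mul_le_of_le_one_right (by positivity) (sum_inv_sq_le_one T))

section Confidence

variable {X H : Type*} [NormedAddCommGroup H] [InnerProductSpace ℝ H] {k : X → X → ℝ} {φ : X → H}
  {σ s γ : ℝ} {n : ℕ}

namespace IsFeatureMap

theorem noiseEnergy_eq_sum (hφ : IsFeatureMap k φ) (hσ : 0 < σ) (x : Fin n → X) (e : Fin n → ℝ) :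
    noiseEnergy k σ x e = ∑ i, (hφ.gram_isHermitian x).eigenvalues i /
      ((hφ.gram_isHermitian x).eigenvalues i + σ ^ 2) *
        (((hφ.gram_isHermitian x).eigenvectorUnitary : Matrix (Fin n) (Fin n) ℝ)ᵀ *ᵥ e) i ^ 2 :=
  dotProduct_mulVec_mulVec_resolvent (hφ.gram_isHermitian x)
    (fun i => (add_pos_of_nonneg_of_pos ((hφ.gram_posSemidef x).eigenvalues_nonneg i)
      (pow_pos hσ 2)).ne') e

theorem noiseEnergy_eq_zero (hφ : IsFeatureMap k φ) (hσ : 0 < σ) (x : Fin n → X) (e : Fin n → ℝ)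
    (hx : infoGain k σ x = 0) : noiseEnergy k σ x e = 0 := by
  have heigenvalues (i : Fin n) : (hφ.gram_isHermitian x).eigenvalues i = 0 :=
    le_antisymm (by simpa [hx] using hφ.eigenvalues_le hσ x i)
      ((hφ.gram_posSemidef x).eigenvalues_nonneg i)
  simp only [hφ.noiseEnergy_eq_sum hσ, heigenvalues, zero_div, zero_mul, Finset.sum_const_zero]

theorem noiseEnergy_le_mul (hφ : IsFeatureMap k φ) (hσ : 0 < σ) (x : Fin n → X) (e : Fin n → ℝ)
    (hs : 0 < s) (hs1 : s ≤ 1) (hxs : min (2 * infoGain k σ x) 1 ≤ s) :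
    noiseEnergy k σ x e ≤ 3 * s * noiseEnergy k (√s * σ) x e := by
  have hshift (i : Fin n) : (hφ.gram_isHermitian x).eigenvalues i + s * σ ^ 2 ≤
      3 * s * ((hφ.gram_isHermitian x).eigenvalues i + σ ^ 2) := by
    have h0 := (hφ.gram_posSemidef x).eigenvalues_nonneg i
    rcases min_le_iff.1 hxs with hgain | hs1'
    · have hexp : Real.exp (2 * infoGain k σ x) - 1 ≤ 2 * s := by
        have h2s := Real.abs_exp_sub_one_le ((abs_of_pos hs).trans_le hs1)
        rw [abs_of_pos hs] at h2s
        linarith [le_of_abs_le h2s, Real.exp_le_exp.2 hgain]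
      have hle : (hφ.gram_isHermitian x).eigenvalues i ≤ σ ^ 2 * (2 * s) :=
        (hφ.eigenvalues_le hσ x i).trans (by gcongr)
      nlinarith [mul_nonneg hs.le h0]
    · rw [le_antisymm hs1 hs1']
      nlinarith [sq_nonneg σ]
  rw [hφ.noiseEnergy_eq_sum hσ, hφ.noiseEnergy_eq_sum (mul_pos (Real.sqrt_pos.2 hs) hσ),
    Finset.mul_sum, mul_pow, Real.sq_sqrt hs.le]
  refine Finset.sum_le_sum fun i _ => ?_
  have h0 := (hφ.gram_posSemidef x).eigenvalues_nonneg i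
  rw [← mul_assoc, ← mul_div_assoc]
  refine mul_le_mul_of_nonneg_right ?_ (sq_nonneg _)
  rw [div_le_div_iff₀ (by positivity) (by positivity)]
  nlinarith [mul_le_mul_of_nonneg_left (hshift i) h0]

theorem infoGain_sqrt_mul_le (hφ : IsFeatureMap k φ) (hs : 0 < s) (hs1 : s ≤ 1) (x : Fin n → X) :
    infoGain k (√s * σ) x ≤ s⁻¹ * infoGain k σ x := by
  rw [hφ.infoGain_eq_sum, hφ.infoGain_eq_sum, mul_left_comm s⁻¹,
    Finset.mul_sum _ _ s⁻¹, mul_pow, Real.sq_sqrt hs.le]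
  gcongr with i
  have h1 := hφ.one_le_one_add_eigenvalues σ x i
  rw [← Real.log_rpow (one_pos.trans_le h1), mul_inv, mul_assoc]
  have hbernoulli := one_add_mul_self_le_rpow_one_add (by linarith) ((one_le_inv₀ hs).2 hs1)
    (s := (σ ^ 2)⁻¹ * (hφ.gram_isHermitian x).eigenvalues i)
  have h0 : 0 ≤ s⁻¹ * ((σ ^ 2)⁻¹ * (hφ.gram_isHermitian x).eigenvalues i) :=
    mul_nonneg (by positivity) (by linarith)
  exact Real.log_le_log (by linarith) hbernoulli

end IsFeatureMap

/-- The ratio `τ² / σ²` of the mixing to the surrogate regularization when the information gain is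
at most `γ`. Being of order `γ` for small `γ`, it keeps the confidence width proportional to `γ`;
the value at `0` only has to be positive. -/
def mixRatio (γ : ℝ) : ℝ :=
  if γ = 0 then 1 else min (2 * γ) 1

theorem mixRatio_pos (hγ : 0 ≤ γ) : 0 < mixRatio γ := by
  rw [mixRatio]
  split_ifs with h
  · exact one_pos
  · exact lt_min (by positivity) one_pos

theorem IsFeatureMap.noiseEnergy_le_of_logMixture_le (hφ : IsFeatureMap k φ) (hσ : 0 < σ)
    (x : Fin n → X) (e : Fin n → ℝ) (hγ : infoGain k σ x ≤ γ) {L : ℝ} (hL : 0 ≤ L)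
    (hM : logMixture k σ (√(mixRatio γ) * σ) x e ≤ 2 * L) :
    (σ ^ 2)⁻¹ * noiseEnergy k σ x e ≤ γ * (24 * L + 6) := by
  have hgain := hφ.infoGain_nonneg σ x
  rcases (hgain.trans hγ).eq_or_lt with rfl | hγ0
  · rw [hφ.noiseEnergy_eq_zero hσ x e (le_antisymm hγ hgain), mul_zero, zero_mul]
  set s := mixRatio γ with hs_def
  have hs : 0 < s := mixRatio_pos hγ0.le
  rw [mixRatio, if_neg hγ0.ne'] at hs_def
  have hs1 : s ≤ 1 := hs_def ▸ min_le_right _ _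
  have hsγ : s ≤ 2 * γ := hs_def ▸ min_le_left _ _
  have hinflate : noiseEnergy k σ x e ≤ 3 * s * noiseEnergy k (√s * σ) x e :=
    hφ.noiseEnergy_le_mul hσ x e hs hs1 (hs_def ▸ by gcongr)
  have hmixed : (σ ^ 2)⁻¹ * noiseEnergy k (√s * σ) x e ≤ 4 * L + 2 * (s⁻¹ * γ) := by
    have hgain_mixed : infoGain k (√s * σ) x ≤ s⁻¹ * γ :=
      (hφ.infoGain_sqrt_mul_le hs hs1 x).trans (by gcongr)
    have hhalf : noiseEnergy k (√s * σ) x e / (2 * σ ^ 2) =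
        (σ ^ 2)⁻¹ * noiseEnergy k (√s * σ) x e / 2 := by
      field_simp
    rw [logMixture, hhalf] at hM
    linarith
  calc (σ ^ 2)⁻¹ * noiseEnergy k σ x e
      ≤ (σ ^ 2)⁻¹ * (3 * s * noiseEnergy k (√s * σ) x e) := by gcongr
    _ = 3 * s * ((σ ^ 2)⁻¹ * noiseEnergy k (√s * σ) x e) := mul_left_comm _ _ _
    _ ≤ 3 * s * (4 * L + 2 * (s⁻¹ * γ)) := by gcongr
    _ = 12 * s * L + 6 * γ := by
        field_simp
        ring
    _ ≤ 12 * (2 * γ) * L + 6 * γ := by gcongr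
    _ = γ * (24 * L + 6) := by ring

theorem IsFeatureMap.abs_sub_postMean_le_sqrt (hφ : IsFeatureMap k φ) (hσ : 0 < σ) (x : Fin n → X)
    (e : Fin n → ℝ) {h : H} {B Q b : ℝ} (hB : ‖h‖ ≤ B) (hQ : (σ ^ 2)⁻¹ * noiseEnergy k σ x e ≤ Q)
    (hb : 2 * B ^ 2 + 2 * Q ≤ b) (z : X) :
    |inner ℝ h (φ z) - postMean k σ x (fun i => inner ℝ h (φ (x i)) + e i) z| ≤
      √b * √(postVar k σ x z) := by
  have hQ0 : 0 ≤ Q :=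
    (mul_nonneg (by positivity) (hφ.noiseEnergy_nonneg hσ x e)).trans hQ
  refine (hφ.abs_sub_postMean_le hσ x e h z).trans ?_
  gcongr
  refine Real.le_sqrt_of_sq_le ?_
  calc (‖h‖ + √((σ ^ 2)⁻¹ * noiseEnergy k σ x e)) ^ 2 ≤ (B + √Q) ^ 2 := by gcongr
    _ ≤ 2 * (B ^ 2 + √Q ^ 2) := add_sq_le
    _ ≤ b := by rwa [Real.sq_sqrt hQ0, mul_add]

theorem two_mul_mul_le_three_hundred_mul_log_pow (hγ : 0 ≤ γ) {L : ℝ} (hL : Real.log 2 ≤ L) :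
    2 * (γ * (24 * L + 6)) ≤ 300 * γ * L ^ 3 := by
  have hL' : 0.69 ≤ L := by linarith [Real.log_two_gt_d9]
  have hpoly : 2 * (24 * L + 6) ≤ 300 * L ^ 3 := by nlinarith [mul_self_nonneg (L - 0.69)]
  nlinarith

theorem IsFeatureMap.abs_sub_postMean_past_le (hφ : IsFeatureMap k φ) (hk : ∀ z, k z z ≤ 1)
    (hσ : 0 < σ) {h : H} {B b δ : ℝ} (hB : ‖h‖ ≤ B) (hδ : 0 < δ) (hδ1 : δ ≤ 1) {t : ℕ} (ht : 1 ≤ t)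
    (hb : 2 * B ^ 2 + 300 * maxInfoGain k σ t * Real.log (t / δ) ^ 3 ≤ b)
    {x : ℕ → X} {e y : ℕ → ℝ} (hy : ∀ s ∈ Set.Ico 1 t, y s = inner ℝ h (φ (x s)) + e s)
    (hM : 2 ≤ t → logMixture k σ (√(mixRatio (maxInfoGain k σ t)) * σ) (past x t) (past e t) ≤
      2 * Real.log (t / δ)) (z : X) :
    |inner ℝ h (φ z) - postMean k σ (past x t) (past y t) z| ≤
      √b * √(postVar k σ (past x t) z) := by
  have hγ := hφ.maxInfoGain_nonneg σ t
  have hobs : past y t = fun i => inner ℝ h (φ (past x t i)) + past e t i :=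
    funext fun i => hy _ ⟨by omega, by omega⟩
  have hlog (r : ℝ) (hr : 0 < r) (hrt : r ≤ t) : Real.log r ≤ Real.log (t / δ) :=
    Real.log_le_log hr (hrt.trans (le_div_self t.cast_nonneg hδ hδ1))
  have hlog0 : 0 ≤ Real.log (t / δ) := by simpa using hlog 1 one_pos (by exact_mod_cast ht)
  rw [hobs]
  rcases ht.eq_or_lt with rfl | ht2
  · refine hφ.abs_sub_postMean_le_sqrt hσ _ _ hB (Q := 0) ?_ (le_trans ?_ hb) z
    · simp [noiseEnergy, dotProduct]
    · rw [mul_zero]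
      gcongr
      positivity
  · have hgain : infoGain k σ (past x t) ≤ maxInfoGain k σ t := by
      obtain ⟨n, rfl⟩ := Nat.exists_eq_add_of_le' ht
      exact hφ.infoGain_le_maxInfoGain_succ hk hσ _ z
    have henergy := hφ.noiseEnergy_le_of_logMixture_le hσ _ _ hgain hlog0 (hM ht2)
    refine hφ.abs_sub_postMean_le_sqrt hσ _ _ hB henergy (le_trans ?_ hb) z
    exact add_le_add le_rfl
      (two_mul_mul_le_three_hundred_mul_log_pow hγ (hlog 2 two_pos (by exact_mod_cast ht2)))

theorem IsFeatureMap.one_sub_le_measureReal_confidence [MeasurableSpace X] {Ω : Type*}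
    {mΩ : MeasurableSpace Ω} {P : Measure Ω} [IsProbabilityMeasure P] {ℱ : Filtration ℕ mΩ}
    {x : ℕ → Ω → X} {ε y : ℕ → Ω → ℝ} {T : ℕ} {β : ℕ → ℝ} {h : H} {B δ : ℝ}
    (hφ : IsFeatureMap k φ) (hk_meas : Measurable (Function.uncurry k)) (hk : ∀ z, k z z ≤ 1)
    (hσ : 0 < σ) (hB : ‖h‖ ≤ B) (hδ : 0 < δ) (hδ1 : δ ≤ 1)
    (hβ : ∀ t ∈ Set.Icc 1 T,
      2 * B ^ 2 + 300 * maxInfoGain k σ t * Real.log (t / δ) ^ 3 ≤ β t)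
    (hx : ∀ t ∈ Set.Icc 1 T, Measurable[ℱ (t - 1)] (x t))
    (hε_meas : ∀ t ∈ Set.Icc 1 T, Measurable[ℱ t] (ε t))
    (hε : ∀ t ∈ Set.Icc 1 T, CondSubGaussian P (ℱ (t - 1)) σ (ε t))
    (hy : ∀ t ∈ Set.Icc 1 T, ∀ ω, y t ω = inner ℝ h (φ (x t ω)) + ε t ω) :
    1 - δ ≤ P.real {ω | ∀ t ∈ Set.Icc 1 T, ∀ z,
      |inner ℝ h (φ z) - postMean k σ (past (fun s => x s ω) t) (past (fun s => y s ω) t) z| ≤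
        √(β t) * √(postVar k σ (past (fun s => x s ω) t) z)} := by
  set good := {ω | ∀ t ∈ Set.Icc 1 T, ∀ z, _}
  set τ : ℕ → ℝ := fun t => √(mixRatio (maxInfoGain k σ t)) * σ
  set bad := {ω | ∃ t ∈ Finset.Icc 2 T, 2 * Real.log (t / δ) ≤
    logMixture k σ (τ t) (past (fun s => x s ω) t) (past (fun s => ε s ω) t)}
  have hτ (t : ℕ) : 0 < τ t :=
    mul_pos (Real.sqrt_pos.2 (mixRatio_pos (hφ.maxInfoGain_nonneg σ t))) hσ
  have hbad : P.real bad ≤ δ ^ 2 := ENNReal.toReal_le_of_le_ofReal (by positivity)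
    (hφ.measure_exists_two_mul_log_le_logMixture_le hk_meas hσ hτ hδ hx hε_meas hε)
  have hcover : good ∪ bad = Set.univ := by
    refine Set.eq_univ_of_forall fun ω => or_iff_not_imp_right.2 fun hω t ht z => ?_
    refine hφ.abs_sub_postMean_past_le hk hσ hB hδ hδ1 ht.1 (hβ t ht)
      (fun s hs => hy s ⟨hs.1, hs.2.le.trans ht.2⟩ ω) (fun ht2 => ?_) z
    exact le_of_not_ge fun hle => hω ⟨t, Finset.mem_Icc.2 ⟨ht2, ht.2⟩, hle⟩
  have hunion : 1 ≤ P.real good + P.real bad := by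
    rw [← probReal_univ (μ := P), ← hcover]
    exact measureReal_union_le good bad
  nlinarith

end Confidence

/-! ### Regret -/

section Regret

variable {X : Type*} {k : X → X → ℝ} {σ : ℝ}

theorem mul_log_one_add_le_log_one_add_mul {c v : ℝ} (hc : 0 ≤ c) (hv0 : 0 ≤ v) (hv1 : v ≤ 1) :
    v * Real.log (1 + c) ≤ Real.log (1 + c * v) := by
  have h1c : 0 < 1 + c := by positivity
  rw [← Real.log_rpow h1c, mul_comm c v]
  exact Real.log_le_log (Real.rpow_pos_of_pos h1c v)
    (rpow_one_add_le_one_add_mul_self (by linarith) hv0 hv1)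

theorem sub_le_of_ucb_le {f : X → ℝ} {x : ℕ → X} {y : ℕ → ℝ} {t : ℕ} {b : ℝ} {z w : X}
    (hconf : ∀ z, |f z - postMean k σ (past x t) (past y t) z| ≤
      √b * √(postVar k σ (past x t) z))
    (hucb : ucb k σ b x y t z ≤ ucb k σ b x y t w) :
    f z - f w ≤ 2 * (√b * √(postVar k σ (past x t) w)) := by
  have hz := (abs_le.1 (hconf z)).2
  have hw := (abs_le.1 (hconf w)).1
  rw [ucb, ucb] at hucb
  linarith

theorem sum_regret_le_sqrt {f : X → ℝ} {x : ℕ → X} {y β : ℕ → ℝ} {T : ℕ} {xstar : X} (hσ : 0 < σ)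
    (hV0 : ∀ t ∈ Set.Icc 1 T, 0 ≤ postVar k σ (past x t) (x t))
    (hV1 : ∀ t ∈ Set.Icc 1 T, postVar k σ (past x t) (x t) ≤ 1) (hβ : ∀ t ∈ Set.Icc 1 T, 0 ≤ β t)
    (hconf : ∀ t ∈ Set.Icc 1 T, ∀ z, |f z - postMean k σ (past x t) (past y t) z| ≤
      √(β t) * √(postVar k σ (past x t) z))
    (hucb : ∀ t ∈ Set.Icc 1 T, ucb k σ (β t) x y t xstar ≤ ucb k σ (β t) x y t (x t)) :
    ∑ t ∈ Finset.Icc 1 T, (f xstar - f (x t)) ≤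
      √(T * ∑ t ∈ Finset.Icc 1 T,
        4 * β t * σ ^ 2 * ((σ ^ 2)⁻¹ / Real.log (1 + (σ ^ 2)⁻¹)) *
          Real.log (1 + (σ ^ 2)⁻¹ * postVar k σ (past x t) (x t))) := by
  set V : ℕ → ℝ := fun t => postVar k σ (past x t) (x t)
  have hinst (t : ℕ) (ht : t ∈ Finset.Icc 1 T) : f xstar - f (x t) ≤ 2 * (√(β t) * √(V t)) :=
    sub_le_of_ucb_le (hconf t (Finset.mem_Icc.1 ht)) (hucb t (Finset.mem_Icc.1 ht))
  have hsq (t : ℕ) (ht : t ∈ Finset.Icc 1 T) : (2 * (√(β t) * √(V t))) ^ 2 ≤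
      4 * β t * σ ^ 2 * ((σ ^ 2)⁻¹ / Real.log (1 + (σ ^ 2)⁻¹)) *
        Real.log (1 + (σ ^ 2)⁻¹ * V t) := by
    replace ht := Finset.mem_Icc.1 ht
    have hβt := hβ t ht
    have hlog : 0 < Real.log (1 + (σ ^ 2)⁻¹) :=
      Real.log_pos (lt_add_of_pos_right 1 (by positivity))
    have hV : V t ≤ Real.log (1 + (σ ^ 2)⁻¹ * V t) / Real.log (1 + (σ ^ 2)⁻¹) :=
      (le_div_iff₀ hlog).2
        (mul_log_one_add_le_log_one_add_mul (by positivity) (hV0 t ht) (hV1 t ht))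
    calc (2 * (√(β t) * √(V t))) ^ 2 = 4 * β t * V t := by
          rw [mul_pow, mul_pow, Real.sq_sqrt hβt, Real.sq_sqrt (hV0 t ht)]
          ring
      _ ≤ 4 * β t * (Real.log (1 + (σ ^ 2)⁻¹ * V t) / Real.log (1 + (σ ^ 2)⁻¹)) := by gcongr
      _ = _ := by
          rw [mul_assoc (4 * β t), ← mul_div_assoc (σ ^ 2), mul_inv_cancel₀ (by positivity)]
          ring
  refine (Finset.sum_le_sum hinst).trans (Real.le_sqrt_of_sq_le ?_)
  calc (∑ t ∈ Finset.Icc 1 T, 2 * (√(β t) * √(V t))) ^ 2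
      ≤ (Finset.Icc 1 T).card * ∑ t ∈ Finset.Icc 1 T, (2 * (√(β t) * √(V t))) ^ 2 :=
        sq_sum_le_card_mul_sum_sq
    _ ≤ _ := by
        rw [Nat.card_Icc, Nat.add_sub_cancel]
        exact mul_le_mul_of_nonneg_left (Finset.sum_le_sum hsq) T.cast_nonneg

end Regret

end GPUCB

end

theorem mainTheorem4_general {X H : Type*} [MeasurableSpace X] [NormedAddCommGroup H]
    [InnerProductSpace ℝ H] {k : X → X → ℝ} {φ : X → H} (hφ : GPUCB.IsFeatureMap k φ)
    (hk_meas : Measurable (Function.uncurry k)) (hk_le : ∀ z, k z z ≤ 1)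
    {f : X → ℝ} {h : H} (hf : ∀ z, f z = inner ℝ h (φ z)) {B : ℝ} (hB : ‖h‖ ≤ B) (xstar : X)
    {σ R : ℝ} (hσ : 0 < σ) (hRσ : |R| ≤ σ) {δ : ℝ} (hδ : 0 < δ) (hδ1 : δ ≤ 1)
    {T : ℕ} {β : ℕ → ℝ}
    (hβ : ∀ t ∈ Set.Icc 1 T,
      2 * B ^ 2 + 300 * GPUCB.maxInfoGain k σ t * Real.log (t / δ) ^ 3 ≤ β t)
    {Ω : Type*} {mΩ : MeasurableSpace Ω} {P : Measure Ω} [IsProbabilityMeasure P]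
    {ℱ : Filtration ℕ mΩ} {x : ℕ → Ω → X} {ε y : ℕ → Ω → ℝ}
    (hx_meas : ∀ t ∈ Set.Icc 1 T, Measurable[ℱ (t - 1)] (x t))
    (hε_meas : ∀ t ∈ Set.Icc 1 T, Measurable[ℱ t] (ε t))
    (hε : ∀ t ∈ Set.Icc 1 T, GPUCB.CondSubGaussian P (ℱ (t - 1)) R (ε t))
    (hy : ∀ t ∈ Set.Icc 1 T, ∀ ω, y t ω = f (x t ω) + ε t ω)
    (hucb : ∀ t ∈ Set.Icc 1 T, ∀ ω,
      GPUCB.ucb k σ (β t) (fun s => x s ω) (fun s => y s ω) t xstar ≤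
        GPUCB.ucb k σ (β t) (fun s => x s ω) (fun s => y s ω) t (x t ω)) :
    1 - δ ≤ P.real {ω | ∑ t ∈ Finset.Icc 1 T, (f xstar - f (x t ω)) ≤
      √(T * ∑ t ∈ Finset.Icc 1 T,
        4 * β t * σ ^ 2 * ((σ ^ 2)⁻¹ / Real.log (1 + (σ ^ 2)⁻¹)) *
          Real.log (1 + (σ ^ 2)⁻¹ *
            GPUCB.postVar k σ (GPUCB.past (fun s => x s ω) t) (x t ω)))} := by
  obtain rfl : f = fun z => inner ℝ h (φ z) := funext hf
  have hβ_nonneg (t : ℕ) (ht : t ∈ Set.Icc 1 T) : 0 ≤ β t := by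
    have hlog : 0 ≤ Real.log (t / δ) := Real.log_nonneg
      ((one_le_div hδ).2 (hδ1.trans (Nat.one_le_cast.2 ht.1)))
    have hgain := hφ.maxInfoGain_nonneg σ t
    exact le_trans (by positivity) (hβ t ht)
  refine (hφ.one_sub_le_measureReal_confidence hk_meas hk_le hσ hB hδ hδ1 hβ hx_meas hε_meas
    (fun t ht => (hε t ht).mono hRσ) hy).trans (measureReal_mono fun ω hconf => ?_)
  exact GPUCB.sum_regret_le_sqrt hσ (fun t _ => hφ.postVar_nonneg hσ _ _)
    (fun t _ => (hφ.postVar_le hσ _ _).trans (hk_le _)) hβ_nonneg hconf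
    fun t ht => hucb t ht ω

theorem mainTheorem4
    -- the compact input space and a fixed measurable kernel bounded by one
    {d : ℕ} (X : Set (EuclideanSpace ℝ (Fin d))) (hX : IsCompact X)
    (k : X → X → ℝ) (hk_meas : Measurable (Function.uncurry k)) (hk_le : ∀ z w, k z w ≤ 1)
    -- the reproducing kernel Hilbert space of the kernel, and the objective in it
    {H : Type*} [NormedAddCommGroup H] [InnerProductSpace ℝ H] [CompleteSpace H]
    [RKHS ℝ H X ℝ] (hH : ∀ z w, RKHS.kernel H z w 1 = k z w)
    (f : H) (B : ℝ) (hB : ‖f‖ ≤ B) (xstar : X) (hstar : ∀ z, f z ≤ f xstar)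
    -- the noise parameter of the surrogate and the sub-Gaussian constant of the noise
    (σ R : ℝ) (hσ : 0 < σ) (hR : 0 ≤ R) (hRσ : R ≤ σ)
    -- the confidence level, the horizon and the exploration parameters
    (δ : ℝ) (hδ : 0 < δ) (hδ' : δ < 1) (T : ℕ) (β : ℕ → ℝ → ℝ)
    (hβ_mono : MonotoneOn (fun t => β t δ) (Set.Icc 1 T))
    (hβ : ∀ t ∈ Set.Icc 1 T,
      2 * B ^ 2 + 300 * GPUCB.maxInfoGain k σ t * Real.log (t / δ) ^ 3 ≤ β t δ)
    -- the queries, the noise and the observations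
    {Ω : Type*} {mΩ : MeasurableSpace Ω} (P : Measure Ω) [IsProbabilityMeasure P]
    (ℱ : Filtration ℕ mΩ) (x : ℕ → Ω → X) (ε y : ℕ → Ω → ℝ)
    (hx_meas : ∀ t ∈ Set.Icc 1 T, Measurable[ℱ (t - 1)] (x t))
    (hε_meas : ∀ t ∈ Set.Icc 1 T, Measurable[ℱ t] (ε t))
    (hε : ∀ t ∈ Set.Icc 1 T, GPUCB.CondSubGaussian P (ℱ (t - 1)) R (ε t))
    (hy : ∀ t ∈ Set.Icc 1 T, ∀ ω, y t ω = f (x t ω) + ε t ω)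
    -- every query maximizes the upper confidence bound
    (hucb : ∀ t ∈ Set.Icc 1 T, ∀ ω, ∀ z,
      GPUCB.ucb k σ (β t δ) (fun s => x s ω) (fun s => y s ω) t z ≤
        GPUCB.ucb k σ (β t δ) (fun s => x s ω) (fun s => y s ω) t (x t ω)) :
    1 - δ ≤ P.real {ω | ∑ t ∈ Finset.Icc 1 T, (f xstar - f (x t ω)) ≤
      √(T * ∑ t ∈ Finset.Icc 1 T,
        4 * β t δ * σ ^ 2 * ((σ ^ 2)⁻¹ / Real.log (1 + (σ ^ 2)⁻¹)) *
          Real.log (1 + (σ ^ 2)⁻¹ *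
            GPUCB.postVar k σ (GPUCB.past (fun s => x s ω) t) (x t ω)))} := by
  exact mainTheorem4_general (GPUCB.isFeatureMap_kerFun hH) hk_meas (fun z => hk_le z z)
    (fun z => by simp [RKHS.inner_kerFun]) hB xstar hσ ((abs_of_nonneg hR).trans_le hRσ) hδ hδ'.le
    hβ hx_meas hε_meas hε hy fun t ht ω => hucb t ht ω xstar
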